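/- **Setting.** Consider the language of first order arithmetic PA with numerals, successor, $+$, $\cdot$, cut-off subtraction $\dot-$, the relations $=,<$, the constants $\top,\bot$ and the connectives $\neg,\land,\lor,\to$, extended by the clause: if $F$ is a formula then $\epsilon x.F$ is a term. The rank of an $\epsilon$-term $\epsilon x.F$ is one more than the maximal rank of the $\epsilon$-subterms of $F$ in which $x$ occurs free (the maximum of the empty set is $0$), and the rank $rk(e)$ of an expression $e$ is the maximal rank of its $\epsilon$-subterms. An $\epsilon$-substitution $S$ is a finite function assigning natural numbers to canonical (closed and minimal) $\epsilon$-terms; $|e|_S$ is the irreducible form of the expression $e$ obtained by computing closed subexpressions from the inside out, with value $0$ for canonical terms outside $dom(S)$; $rk(S)$ is the maximal rank of an element of $dom(S)$, and $0$ if $S=\emptyset$. Let $Cr$ be a finite sequence of closed $\epsilon$-axioms $F[t]\to \epsilon x.F[x]\not> t\land F[\epsilon x.F[x]]$. $S$ is *solving* if all members of $Cr$ are true under $S$. The *H-process* for $Cr$ is $S^0=\emptyset$, $S^{n+1}=S^n$ if $S^n$ is solving, and otherwise, where the displayed axiom is the first member of $Cr$ that is false under $S^n$, and $e=\epsilon x.|F|_{S^n}$,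 $v=|t|_{S^n}$, $$S^{n+1}=\{(f,u)\in S^n: rk(f)<rk(e)\}\cup\{(f,u)\in S^n: rk(f)=rk(e),\ f\not\equiv e\}\cup\{(e,v)\}.$$ Put $r_n=rk(S^n)$ and $a_n=ind(S^n)$ if $S^n$ is nonsolving, and $r_n=a_n=0$ otherwise. Here $$ind(S)=(\omega+1)^{N-1}\varphi(e_{N-1};S)+\cdots+(\omega+1)^0\varphi(e_0;S),$$ where $e_0,\dots,e_{N-1}$ lists without repetition the closed $\epsilon$-terms occurring in $Cr$, each before its proper subterms, and $\varphi(e;S)=\omega$ if $|e|_S=0$, $\varphi(e;S)=|e|_S-1$ otherwise. Let $\mathrm{RANK}=\max\{rk(Cr)+1,2\}$, where $rk(Cr)$ is the maximal rank of a member of $Cr$. To a series $\vec S^{m,k}=(S^m,\dots,S^{k-1})$ associate ordinals $o(\vec S^{m,k};\xi)<\varepsilon_0$ for $\xi\le\mathrm{RANK}$: $o(\vec S^{m,k};\mathrm{RANK})=a_m$; and for $\xi<\mathrm{RANK}$, if $m=k_0<k_1<\dots<k_l$ are $m$ and the indices $i\in(m,k)$ with $r_i=\xi$, and $k_{l+1}=k$,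 then $o(\vec S^{m,k};\xi)=\sum_{j\le l}2^{o(\vec S^{k_j,k_{j+1}};\,\xi+1)}$. Put $o(\vec S^{m,k})=o(\vec S^{m,k};0)$. Define $M(p,n)=M(p,n;Cr)$ by $M(0,n)=n+1$ and, with $e_p(n):=o(\vec S^{n,M(p,n)})$, $$M(p+1,n)=\begin{cases} n & S^n\text{ solving},\\ M(p+1,M(p,n)) & S^n\text{ nonsolving},\ r_{M(p,n)}\ge r_n,\ e_p(M(p,n))<e_p(n),\\ M(p,n) & \text{otherwise.}\end{cases}$$ A number-theoretic function is *$\varepsilon_0$-recursive* (Tait) if it is generated from the schemata for primitive recursive functions together with the schema $$f(\vec y,x)=\begin{cases} h(\vec y,x,f(\vec y,d(\vec y,x))) & d(\vec y,x)<_{\varepsilon_0}x,\\ g(\vec y,x)&\text{otherwise,}\end{cases}$$ where $<_{\varepsilon_0}$ is the standard well ordering of type $\varepsilon_0$ of codes of Cantor normal forms, with least element $0$. **Lemma.** The function $(p,n,Cr)\mapsto M(p,n;Cr)$, with $Cr$ given by its Gödel number, is $\varepsilon_0$-recursive; i.e. there is one $\varepsilon_0$-recursive function $f$ of three arguments with $f(p,n,\ulcorner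 Cr\urcorner)=M(p,n;Cr)$ for all $p,n$ and all finite sequences $Cr$ of closed $\epsilon$-axioms. -/

import Mathlib

namespace EpsSubst

/-! ## Ordinal recursive functions -/

/-- Code of a Cantor normal form term `ω ^ e * n + a`; the code of `0` is `0`. -/
def ordCode : ONote → ℕ
  | ONote.zero => 0
  | ONote.oadd e n a => Nat.pair (ordCode e) (Nat.pair n.natPred (ordCode a)) + 1

/-- The standard well ordering of type `ε₀` on natural numbers: its field consists of the codes
of the ordinal notations in Cantor normal form, ordered as the ordinals they denote. -/
def LtEps0 (x y : ℕ) : Prop :=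
  ∃ a b : NONote, ordCode a.1 = x ∧ ordCode b.1 = y ∧ a < b

/-- The number-theoretic functions generated by the schemata for primitive recursive functions
together with the schema of recursion along the relation `lt`:
`f(y, x) = h(y, x, f(y, d(y, x)))` if `d(y, x)` is `lt`-below `x`, and `f(y, x) = g(y, x)`
otherwise. (The recursion variable `x` is written first.) -/
inductive RelRecursive (lt : ℕ → ℕ → Prop) : {n : ℕ} → (List.Vector ℕ n → ℕ) → Prop
  | zero : RelRecursive lt (n := 0) (fun _ => 0)
  | succ : RelRecursive lt (n := 1) (fun v => Nat.succ v.head)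
  | get {n : ℕ} (i : Fin n) : RelRecursive lt (fun v => v.get i)
  | comp {m n : ℕ} {f : List.Vector ℕ n → ℕ} (g : Fin n → List.Vector ℕ m → ℕ) :
      RelRecursive lt f → (∀ i, RelRecursive lt (g i)) →
        RelRecursive lt (fun a => f (List.Vector.ofFn fun i => g i a))
  | prec {n : ℕ} {f : List.Vector ℕ n → ℕ} {g : List.Vector ℕ (n + 2) → ℕ} :
      RelRecursive lt f → RelRecursive lt g →
        RelRecursive lt (n := n + 1) (fun v =>
          v.head.rec (f v.tail) (fun y ih => g (y ::ᵥ ih ::ᵥ v.tail)))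
  | ordRec {n : ℕ} {f g d : List.Vector ℕ (n + 1) → ℕ} {h : List.Vector ℕ (n + 2) → ℕ} :
      RelRecursive lt g → RelRecursive lt h → RelRecursive lt d →
      (∀ (x : ℕ) (y : List.Vector ℕ n), ¬ lt (d (x ::ᵥ y)) x → f (x ::ᵥ y) = g (x ::ᵥ y)) →
      (∀ (x : ℕ) (y : List.Vector ℕ n), lt (d (x ::ᵥ y)) x →
        f (x ::ᵥ y) = h (f (d (x ::ᵥ y) ::ᵥ y) ::ᵥ x ::ᵥ y)) →
      RelRecursive lt f

/-- `ε₀`-recursive functions. -/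
def Eps0Recursive {n : ℕ} (f : List.Vector ℕ n → ℕ) : Prop :=
  RelRecursive LtEps0 f

/-! ## The language of first order arithmetic with epsilon terms -/

inductive Kind
  | tm
  | fm

/-- Expressions (terms and formulas, defined simultaneously) with de Bruijn indices;
`eps F` is the epsilon term `εx.F[x]`, in which `x` is the variable `0` of `F`. -/
inductive Expr : Kind → Type
  | var : ℕ → Expr Kind.tm
  | num : ℕ → Expr Kind.tm
  | succ : Expr Kind.tm → Expr Kind.tm
  | add : Expr Kind.tm → Expr Kind.tm → Expr Kind.tm
  | mul : Expr Kind.tm → Expr Kind.tm → Expr Kind.tm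
  | monus : Expr Kind.tm → Expr Kind.tm → Expr Kind.tm
  | eps : Expr Kind.fm → Expr Kind.tm
  | top : Expr Kind.fm
  | bot : Expr Kind.fm
  | eq : Expr Kind.tm → Expr Kind.tm → Expr Kind.fm
  | lt : Expr Kind.tm → Expr Kind.tm → Expr Kind.fm
  | neg : Expr Kind.fm → Expr Kind.fm
  | and : Expr Kind.fm → Expr Kind.fm → Expr Kind.fm
  | or : Expr Kind.fm → Expr Kind.fm → Expr Kind.fm
  | imp : Expr Kind.fm → Expr Kind.fm → Expr Kind.fm
  deriving DecidableEq

abbrev Tm := Expr Kind.tm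
abbrev Fm := Expr Kind.fm

namespace Expr

/-- Gödel numbers of expressions. -/
def code : {s : Kind} → Expr s → ℕ
  | _, var i => Nat.pair 0 i
  | _, num n => Nat.pair 1 n
  | _, succ a => Nat.pair 2 (code a)
  | _, add a b => Nat.pair 3 (Nat.pair (code a) (code b))
  | _, mul a b => Nat.pair 4 (Nat.pair (code a) (code b))
  | _, monus a b => Nat.pair 5 (Nat.pair (code a) (code b))
  | _, eps F => Nat.pair 6 (code F)
  | _, top => Nat.pair 7 0
  | _, bot => Nat.pair 8 0
  | _, eq a b => Nat.pair 9 (Nat.pair (code a) (code b))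
  | _, lt a b => Nat.pair 10 (Nat.pair (code a) (code b))
  | _, neg F => Nat.pair 11 (code F)
  | _, and F G => Nat.pair 12 (Nat.pair (code F) (code G))
  | _, or F G => Nat.pair 13 (Nat.pair (code F) (code G))
  | _, imp F G => Nat.pair 14 (Nat.pair (code F) (code G))

/-- All free variables of the expression are `< k`; closed means `closedAt 0`. -/
def closedAt : {s : Kind} → Expr s → ℕ → Bool
  | _, var i, k => decide (i < k)
  | _, num _, _ => true
  | _, succ a, k => closedAt a k
  | _, add a b, k => closedAt a k && closedAt b k
  | _, mul a b, k => closedAt a k && closedAt b k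
  | _, monus a b, k => closedAt a k && closedAt b k
  | _, eps F, k => closedAt F (k + 1)
  | _, top, _ => true
  | _, bot, _ => true
  | _, eq a b, k => closedAt a k && closedAt b k
  | _, lt a b, k => closedAt a k && closedAt b k
  | _, neg F, k => closedAt F k
  | _, and F G, k => closedAt F k && closedAt G k
  | _, or F G, k => closedAt F k && closedAt G k
  | _, imp F G, k => closedAt F k && closedAt G k

/-- The variable `k` occurs free. -/
def occurs : {s : Kind} → Expr s → ℕ → Bool
  | _, var i, k => decide (i = k)
  | _, num _, _ => false
  | _, succ a, k => occurs a k
  | _, add a b, k => occurs a k || occurs b k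
  | _, mul a b, k => occurs a k || occurs b k
  | _, monus a b, k => occurs a k || occurs b k
  | _, eps F, k => occurs F (k + 1)
  | _, top, _ => false
  | _, bot, _ => false
  | _, eq a b, k => occurs a k || occurs b k
  | _, lt a b, k => occurs a k || occurs b k
  | _, neg F, k => occurs F k
  | _, and F G, k => occurs F k || occurs G k
  | _, or F G, k => occurs F k || occurs G k
  | _, imp F G, k => occurs F k || occurs G k

/-- Substitution of a closed term `t` for the variable `k`. -/
def inst : {s : Kind} → Expr s → ℕ → Tm → Expr s
  | _, var i, k, t => if i = k then t else if k < i then var (i - 1) else var i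
  | _, num n, _, _ => num n
  | _, succ a, k, t => succ (inst a k t)
  | _, add a b, k, t => add (inst a k t) (inst b k t)
  | _, mul a b, k, t => mul (inst a k t) (inst b k t)
  | _, monus a b, k, t => monus (inst a k t) (inst b k t)
  | _, eps F, k, t => eps (inst F (k + 1) t)
  | _, top, _, _ => top
  | _, bot, _, _ => bot
  | _, eq a b, k, t => eq (inst a k t) (inst b k t)
  | _, lt a b, k, t => lt (inst a k t) (inst b k t)
  | _, neg F, k, t => neg (inst F k t)
  | _, and F G, k, t => and (inst F k t) (inst G k t)
  | _, or F G, k, t => or (inst F k t) (inst G k t)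
  | _, imp F G, k, t => imp (inst F k t) (inst G k t)

/-- The maximal rank of the epsilon subterms in which the variable `k` occurs free, where the
rank of an epsilon term `εx.F` is one more than the maximal rank of the epsilon subterms of `F`
in which `x` occurs free (maximum over the empty set being `0`). -/
def occRank : {s : Kind} → Expr s → ℕ → ℕ
  | _, var _, _ => 0
  | _, num _, _ => 0
  | _, succ a, k => occRank a k
  | _, add a b, k => max (occRank a k) (occRank b k)
  | _, mul a b, k => max (occRank a k) (occRank b k)
  | _, monus a b, k => max (occRank a k) (occRank b k)
  | _, eps F, k => max (if occurs F (k + 1) then occRank F 0 + 1 else 0) (occRank F (k + 1))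
  | _, top, _ => 0
  | _, bot, _ => 0
  | _, eq a b, k => max (occRank a k) (occRank b k)
  | _, lt a b, k => max (occRank a k) (occRank b k)
  | _, neg F, k => occRank F k
  | _, and F G, k => max (occRank F k) (occRank G k)
  | _, or F G, k => max (occRank F k) (occRank G k)
  | _, imp F G, k => max (occRank F k) (occRank G k)

/-- The rank of an expression: the maximal rank of its epsilon subterms. -/
def rk : {s : Kind} → Expr s → ℕ
  | _, var _ => 0
  | _, num _ => 0
  | _, succ a => rk a
  | _, add a b => max (rk a) (rk b)
  | _, mul a b => max (rk a) (rk b)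
  | _, monus a b => max (rk a) (rk b)
  | _, eps F => max (occRank F 0 + 1) (rk F)
  | _, top => 0
  | _, bot => 0
  | _, eq a b => max (rk a) (rk b)
  | _, lt a b => max (rk a) (rk b)
  | _, neg F => rk F
  | _, and F G => max (rk F) (rk G)
  | _, or F G => max (rk F) (rk G)
  | _, imp F G => max (rk F) (rk G)

/-- The closed epsilon terms occurring in an expression, each term before its subterms. -/
def closedEps : {s : Kind} → Expr s → List Tm
  | _, var _ => []
  | _, num _ => []
  | _, succ a => closedEps a
  | _, add a b => closedEps a ++ closedEps b
  | _, mul a b => closedEps a ++ closedEps b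
  | _, monus a b => closedEps a ++ closedEps b
  | _, eps F => (if closedAt F 1 then [eps F] else []) ++ closedEps F
  | _, top => []
  | _, bot => []
  | _, eq a b => closedEps a ++ closedEps b
  | _, lt a b => closedEps a ++ closedEps b
  | _, neg F => closedEps F
  | _, and F G => closedEps F ++ closedEps G
  | _, or F G => closedEps F ++ closedEps G
  | _, imp F G => closedEps F ++ closedEps G

/-- The number denoted by a numeral. -/
def val : Tm → ℕ
  | num n => n
  | _ => 0

/-- Compute a binary function symbol at numerals. -/
def evalFn (c : Tm → Tm → Tm) (f : ℕ → ℕ → ℕ) : Tm → Tm → Tm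
  | num m, num n => num (f m n)
  | a, b => c a b

def evalSucc : Tm → Tm
  | num m => num (m + 1)
  | a => succ a

def ofBool : Bool → Fm
  | true => top
  | false => bot

/-- Compute a binary relation symbol at numerals. -/
def evalRel (c : Tm → Tm → Fm) (f : ℕ → ℕ → Bool) : Tm → Tm → Fm
  | num m, num n => ofBool (f m n)
  | a, b => c a b

/-- The truth value denoted by one of the constants `top`, `bot`. -/
def truth : Fm → Option Bool
  | top => some true
  | bot => some false
  | _ => none

def evalNeg (F : Fm) : Fm :=
  match truth F with
  | some b => ofBool (!b)
  | none => neg F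

/-- Compute a binary connective at truth values. -/
def evalConn (c : Fm → Fm → Fm) (f : Bool → Bool → Bool) (F G : Fm) : Fm :=
  match truth F, truth G with
  | some a, some b => ofBool (f a b)
  | _, _ => c F G

end Expr

/-! ## Epsilon substitutions -/

/-- A finite function from canonical epsilon terms to numbers, given by its list of pairs. -/
abbrev Subst := List (Tm × ℕ)

/-- The value of a canonical epsilon term, with default value `0` outside of the domain. -/
def Subst.app (S : Subst) (e : Tm) : ℕ := (S.lookup e).getD 0

/-- The irreducible form `|e|_S` of an expression: closed terms become numerals and closed
formulas become truth values, from the inside out. When the body of a closed epsilon term has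
been reduced, the term is canonical and it is replaced by its value under `S`. -/
def Subst.red (S : Subst) : {s : Kind} → Expr s → Expr s
  | _, Expr.var i => Expr.var i
  | _, Expr.num n => Expr.num n
  | _, Expr.succ a => Expr.evalSucc (red S a)
  | _, Expr.add a b => Expr.evalFn Expr.add (fun m n => m + n) (red S a) (red S b)
  | _, Expr.mul a b => Expr.evalFn Expr.mul (fun m n => m * n) (red S a) (red S b)
  | _, Expr.monus a b => Expr.evalFn Expr.monus (fun m n => m - n) (red S a) (red S b)
  | _, Expr.eps F =>
      if Expr.closedAt F 1 then Expr.num (S.app (Expr.eps (red S F))) else Expr.eps (red S F)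
  | _, Expr.top => Expr.top
  | _, Expr.bot => Expr.bot
  | _, Expr.eq a b => Expr.evalRel Expr.eq (fun m n => decide (m = n)) (red S a) (red S b)
  | _, Expr.lt a b => Expr.evalRel Expr.lt (fun m n => decide (m < n)) (red S a) (red S b)
  | _, Expr.neg F => Expr.evalNeg (red S F)
  | _, Expr.and F G => Expr.evalConn Expr.and (fun a b => a && b) (red S F) (red S G)
  | _, Expr.or F G => Expr.evalConn Expr.or (fun a b => a || b) (red S F) (red S G)
  | _, Expr.imp F G => Expr.evalConn Expr.imp (fun a b => !a || b) (red S F) (red S G)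

/-- `rk(S)`, the maximal rank of the elements of the domain, and `0` for the empty function. -/
def Subst.rk (S : Subst) : ℕ := (S.map fun q => q.1.rk).foldr max 0

/-- A closed epsilon axiom, determined by the formula `F[x]` and the closed term `t`. -/
structure CritAxiom where
  F : Fm
  t : Tm
  closed_F : F.closedAt 1 = true
  closed_t : t.closedAt 0 = true

/-- The epsilon axiom `F[t] → (εx.F[x] ≯ t) ∧ F[εx.F[x]]` itself. -/
def CritAxiom.formula (c : CritAxiom) : Fm :=
  Expr.imp (c.F.inst 0 c.t)
    (Expr.and (Expr.neg (Expr.lt c.t (Expr.eps c.F))) (c.F.inst 0 (Expr.eps c.F)))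

/-- Finite sequences of closed epsilon axioms. -/
abbrev CritSeq := List CritAxiom

/-- The Gödel number of a finite sequence of epsilon axioms: the code of the sequence of the
Gödel numbers of its members. -/
def CritSeq.code (Cr : CritSeq) : ℕ := Encodable.encode (Cr.map fun c => c.formula.code)

namespace HProc

/-- `S` validates every axiom in `Cr`. -/
def Solving (Cr : CritSeq) (S : Subst) : Prop := ∀ c ∈ Cr, S.red c.formula = Expr.top

instance (Cr : CritSeq) (S : Subst) : Decidable (Solving Cr S) :=
  inferInstanceAs (Decidable (∀ c ∈ Cr, S.red c.formula = Expr.top))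

/-- The epsilon axiom `Cr(S)`: the first axiom in `Cr` that `S` does not validate. -/
def falseAxiom (Cr : CritSeq) (S : Subst) : Option CritAxiom :=
  Cr.find? fun c => decide (S.red c.formula ≠ Expr.top)

/-- The next substitution; a solving substitution is left unchanged. -/
def step (Cr : CritSeq) (S : Subst) : Subst :=
  match falseAxiom Cr S with
  | none => S
  | some c =>
      let e : Tm := Expr.eps (S.red c.F)
      let v : ℕ := (S.red c.t).val
      (e, v) :: S.filter fun q => decide (q.1.rk < e.rk ∨ (q.1.rk = e.rk ∧ q.1 ≠ e))

/-- The H-process `S^0, S^1, …` for `Cr`. -/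
def proc (Cr : CritSeq) : ℕ → Subst
  | 0 => []
  | n + 1 => step Cr (proc Cr n)

/-- `r_n = rk(S^n)` for nonsolving `S^n`, and `0` otherwise. -/
def r (Cr : CritSeq) (n : ℕ) : ℕ := if Solving Cr (proc Cr n) then 0 else (proc Cr n).rk

/-- `RANK(Cr) = max {rk(Cr) + 1, 2}`. -/
def RANK (Cr : CritSeq) : ℕ := max ((Cr.map fun c => c.formula.rk).foldr max 0 + 1) 2

/-- The closed epsilon terms `e_0, …, e_{N-1}` occurring in `Cr`, without repetitions, arranged
in such a way that each term comes before its subterms. -/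
def closedTerms (Cr : CritSeq) : List Tm := (Cr.flatMap fun c => c.formula.closedEps).dedup

open Ordinal in
/-- The order type `‖v‖_A` of `v` in the Ackermann ordering `1 <_A 2 <_A … <_A 0`. -/
noncomputable def ackType (v : ℕ) : Ordinal.{0} := if v = 0 then ω else ((v - 1 : ℕ) : Ordinal.{0})

open Ordinal in
/-- The index `(ω+1)^(N-1) · φ(e_{N-1}; S) + … + (ω+1)^0 · φ(e_0; S)`, where
`φ(e; S)` is the Ackermann order type of the value of `e` under `S`. -/
noncomputable def ind (Cr : CritSeq) (S : Subst) : Ordinal.{0} :=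
  (((closedTerms Cr).zipIdx.map fun q =>
    (ω + 1) ^ (q.2 : Ordinal.{0}) * ackType (S.red q.1).val).reverse).sum

/-- `a_n = ind(S^n)` for nonsolving `S^n`, and `0` otherwise. -/
noncomputable def a (Cr : CritSeq) (n : ℕ) : Ordinal.{0} :=
  if Solving Cr (proc Cr n) then 0 else ind Cr (proc Cr n)

/-- The starting points of the substrings into which the series `S^m, …, S^(k-1)` is divided
at the later places of rank `ξ`. -/
def starts (Cr : CritSeq) (ξ m k : ℕ) : List ℕ :=
  m :: (List.range' (m + 1) (k - (m + 1))).filter fun i => decide (r Cr i = ξ)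

/-- The ordinal `o(S^m, …, S^(k-1); ξ)` of a series, for `ξ = RANK(Cr) - j`. It is the index of
`S^m` for `ξ = RANK(Cr)`, and for `ξ < RANK(Cr)` it is the sum of `2 ^ o(T; ξ + 1)` over the
substrings `T` into which the series is divided at the places of rank `ξ`. -/
noncomputable def oAux (Cr : CritSeq) : ℕ → ℕ → ℕ → Ordinal.{0}
  | 0, m, _ => a Cr m
  | j + 1, m, k =>
      let ks := starts Cr (RANK Cr - (j + 1)) m k
      (List.zipWith (fun b c => (2 : Ordinal.{0}) ^ oAux Cr j b c) ks (ks.tail ++ [k])).sum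

/-- The ordinal `o(S^m, …, S^(k-1)) = o(S^m, …, S^(k-1); 0)`, which is below `ε₀`. -/
noncomputable def o (Cr : CritSeq) (m k : ℕ) : Ordinal.{0} := oAux Cr (RANK Cr) m k

/-- The function `M(p + 1, ·)` in terms of `Mp = M(p, ·)`; the ordinal denoted by `e_p(n)` is
`o Cr n (Mp n)`. -/
noncomputable def MStep (Cr : CritSeq) (Mp : ℕ → ℕ) (n : ℕ) : ℕ :=
  if Solving Cr (proc Cr n) then n
  else if _h : o Cr (Mp n) (Mp (Mp n)) < o Cr n (Mp n) then
    if r Cr (Mp n) < r Cr n then Mp n else MStep Cr Mp (Mp n)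
  else Mp n
termination_by o Cr n (Mp n)
decreasing_by exact _h

/-- `M(p, n; Cr)`. -/
noncomputable def M (Cr : CritSeq) : ℕ → ℕ → ℕ
  | 0, n => n + 1
  | p + 1, n => MStep Cr (M Cr p) n

end HProc

end EpsSubst

/-!
The function `M` is computed by a deterministic machine whose transitions are primitive recursive
and which carries a primitive recursive ordinal measure below `ε₀`; running it takes a single
application of the schema of recursion along `<_{ε₀}`.

*The machine.* A state is a value together with a stack of tasks. To compute `M(q + 1, n)` it
computes `m = M(q, n)` and `M(q, m)`, and as long as the test on ordinals and ranks succeeds it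
passes from `n` to `m`, remembering `M(q, m)`. So the stack holds tasks of decreasing levels `q`,
and a loop of level `q` carries the ordinal `e_q(n)`, which the test makes smaller at each
repetition. All these ordinals lie below a tower `T` of exponentials that depends on `RANK` only
(`oAux_lt_tower`). Hence a task of level `q` may be given an exponent `ω ^ γ * (q + 1) + w`, with
`w` equal to `ω ^ e_q(n)` while it loops, `ω ^ T` before its first value of `e_q` is known, and `0`
when it is still to be started. The sum of the powers of `ω` with these exponents, taken from the
bottom of the stack to its top, is a Cantor normal form, and it decreases with each step
(`run_pop`, `run_push`). That the machine computes `M` is shown in `run_eval`, by induction on the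
level and, for each loop, by induction on `e_q(n)`.

*Ordinal recursion.* In the schema the recursion argument is only a number, while the machine has a
state as well. The two are combined in the notation `ω ^ μ * (⌜s⌝ + 1)` of a state `s` of measure
`μ` (`exists_run`).

*Primitive recursion.* It remains to see that transitions and measure are primitive recursive.
The coding of ordinal notations is a bijection of `ONote` with the natural numbers, so that `ONote`
becomes a `Primcodable` type in which comparison, addition and `x ↦ 2 ^ x` are primitive recursive.
The syntactic notions and the reduction `|e|_S` are defined by course-of-values recursion on Gödel
numbers (`codeRec`). Substitution into formulas is not needed, since `F` and `t` can be read off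
from the subformula `¬ t < εx.F` of an axiom. The ordinals `o` are given notations by the same
recursion that defines them (`nf_repr_oNote`).
-/

namespace EpsSubst

open Ordinal

/-! ### Ordinal notations as natural numbers -/

/-- The ordinal notation coded by a natural number. -/
def ordDecode : ℕ → ONote
  | 0 => 0
  | x + 1 =>
    ONote.oadd (ordDecode x.unpair.1) x.unpair.2.unpair.1.succPNat
      (ordDecode x.unpair.2.unpair.2)
termination_by x => x
decreasing_by
  · exact Nat.lt_succ_of_le (Nat.unpair_left_le x)
  · exact Nat.lt_succ_of_le ((Nat.unpair_right_le _).trans (Nat.unpair_right_le x))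

theorem ordDecode_ordCode (x : ONote) : ordDecode (ordCode x) = x := by
  induction x with
  | zero => simp [ordCode, ordDecode]
  | oadd e n a he ha => simp [ordCode, ordDecode, he, ha]

theorem ordCode_ordDecode (x : ℕ) : ordCode (ordDecode x) = x := by
  induction x using Nat.strong_induction_on with
  | _ x ih =>
    cases x with
    | zero => rw [ordDecode]; rfl
    | succ x =>
      rw [ordDecode, ordCode, ih _ (Nat.lt_succ_of_le (Nat.unpair_left_le x)),
        ih _ (Nat.lt_succ_of_le ((Nat.unpair_right_le _).trans (Nat.unpair_right_le x)))]
      simp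

/-- Every natural number codes exactly one ordinal notation (not necessarily in normal form). -/
def ordEquiv : ONote ≃ ℕ := ⟨ordCode, ordDecode, ordDecode_ordCode, ordCode_ordDecode⟩

instance : Primcodable ONote := Primcodable.ofEquiv ℕ ordEquiv

theorem ltEps0_ordCode {x y : ONote} (hx : x.NF) (hy : y.NF) (h : x < y) :
    LtEps0 (ordCode x) (ordCode y) :=
  ⟨⟨x, hx⟩, ⟨y, hy⟩, rfl, rfl, h⟩

theorem wellFounded_ltEps0 : WellFounded LtEps0 := by
  refine Subrelation.wf (r := InvImage (· < ·) fun x => (ordDecode x).repr) ?_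
    (InvImage.wf _ Ordinal.lt_wf)
  rintro _ _ ⟨a, b, rfl, rfl, h⟩
  simp only [InvImage, ordDecode_ordCode]
  exact h

/-! ### Ordinal recursive functions and iteration along a descending measure -/

theorem relRecursive_of_primrec {lt : ℕ → ℕ → Prop} {n : ℕ} {f : List.Vector ℕ n → ℕ}
    (hf : Primrec f) : RelRecursive lt f := by
  induction Nat.Primrec'.of_prim hf with
  | zero => exact .zero
  | succ => exact .succ
  | get i => exact .get i
  | comp g _ _ ihf ihg =>
    exact .comp g (ihf (Nat.Primrec'.prim_iff.1 ‹_›)) fun i =>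
      ihg i (Nat.Primrec'.prim_iff.1 (by solve_by_elim))
  | prec _ _ ihf ihg =>
    exact .prec (ihf (Nat.Primrec'.prim_iff.1 ‹_›)) (ihg (Nat.Primrec'.prim_iff.1 ‹_›))

section Machine

variable {σ : Type} [Primcodable σ]

/-- The notation `ω ^ μ * (⌜s⌝ + 1)` of a state `s` of measure `μ`: the state can be read off from
it, and it decreases whenever the measure does. -/
def stateNote (mu : σ → ONote) (s : σ) : ONote :=
  ONote.oadd (mu s) (Encodable.encode s).succPNat 0

/-- The state whose `stateNote` has the given code. -/
def stateOf (x : ℕ) : Option σ := Encodable.decode (x - 1).unpair.2.unpair.1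

theorem stateOf_stateNote (mu : σ → ONote) (s : σ) :
    (stateOf (ordCode (stateNote mu s)) : Option σ) = some s := by
  simp [stateOf, stateNote, ordCode]

open Classical in
/-- A primitive recursive transition system with a primitive recursive measure can be run by
ordinal recursion, as long as the measure decreases. -/
theorem exists_run {step : ℕ → σ → σ} {mu : ℕ → σ → ONote} {out : ℕ → σ → ℕ}
    (hstep : Primrec₂ step) (hmu : Primrec₂ mu) (hout : Primrec₂ out) :
    ∃ run : ℕ → σ → ℕ,
      (∀ c s, (mu c s).NF → (mu c (step c s)).NF → mu c (step c s) < mu c s →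
        run c s = run c (step c s)) ∧
      (∀ c s, step c s = s → run c s = out c s) ∧
      ∀ {n : ℕ} {p : List.Vector ℕ n → ℕ} {s : List.Vector ℕ n → σ}, Primrec p → Primrec s →
        Eps0Recursive fun v => run (p v) (s v) := by
  have hcode : Primrec₂ fun (c : ℕ) (s : σ) => ordCode (stateNote (mu c) s) := by
    have h1 : Primrec₂ fun (c : ℕ) (s : σ) => ordCode (mu c s) :=
      (Primrec.of_equiv (e := ordEquiv)).comp₂ hmu
    have h2 : Primrec₂ fun (_ : ℕ) (s : σ) => Encodable.encode s :=
      Primrec.encode.comp₂ Primrec₂.right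
    exact (Primrec.succ.comp₂ (Primrec₂.natPair.comp₂ h1
      (Primrec₂.natPair.comp₂ h2 (Primrec₂.const 0)))).of_eq fun c s => by
        simp [stateNote, ordCode, ← ONote.zero_def]
  have hstate : Primrec (stateOf : ℕ → Option σ) :=
    Primrec.decode.comp <| Primrec.fst.comp <| Primrec.unpair.comp <| Primrec.snd.comp <|
      Primrec.unpair.comp <| Primrec.pred
  -- Numbers that do not code a state are fixed by `d`, so that the recursion stops there.
  let d : ℕ → ℕ → ℕ := fun c x =>
    ((stateOf x : Option σ).map fun s => ordCode (stateNote (mu c) (step c s))).getD x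
  let g : ℕ → ℕ → ℕ := fun c x => ((stateOf x : Option σ).map (out c)).getD 0
  have hd : Primrec₂ d := Primrec.option_getD.comp
    (Primrec.option_map (hstate.comp Primrec.snd)
      (hcode.comp (Primrec.fst.comp Primrec.fst)
        (hstep.comp (Primrec.fst.comp Primrec.fst) Primrec.snd))) Primrec.snd
  have hg : Primrec₂ g := Primrec.option_getD.comp
    (Primrec.option_map (hstate.comp Primrec.snd)
      (hout.comp (Primrec.fst.comp Primrec.fst) Primrec.snd)) (Primrec.const 0)
  let F : ℕ → ℕ → ℕ := fun c => wellFounded_ltEps0.fix fun x ih =>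
    if h : LtEps0 (d c x) x then ih (d c x) h else g c x
  have F_eq : ∀ c x, F c x = if LtEps0 (d c x) x then F c (d c x) else g c x := by
    intro c x
    simp only [F]
    rw [WellFounded.fix_eq]
    simp
  have hd' : ∀ c s, d c (ordCode (stateNote (mu c) s)) = ordCode (stateNote (mu c) (step c s)) := by
    intro c s
    simp [d, stateOf_stateNote]
  refine ⟨fun c s => F c (ordCode (stateNote (mu c) s)), ?_, ?_, ?_⟩
  · intro c s h1 h2 h
    change F c _ = F c _
    rw [F_eq, hd', if_pos]
    exact ltEps0_ordCode (ONote.NF.oadd_zero _ _) (ONote.NF.oadd_zero _ _)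
      (ONote.oadd_lt_oadd_1 (ONote.NF.oadd_zero _ _) h)
  · intro c s h
    -- A halting state is its own successor, and `LtEps0` is irreflexive.
    change F c _ = out c s
    rw [F_eq, hd', h, if_neg]
    · simp [g, stateOf_stateNote]
    · exact fun h => wellFounded_ltEps0.asymmetric _ _ h h
  · intro n p s hp hs
    have hF : Eps0Recursive fun v : List.Vector ℕ 2 => F (v.get 1) (v.get 0) := by
      refine RelRecursive.ordRec (g := fun v => g (v.get 1) (v.get 0))
        (d := fun v => d (v.get 1) (v.get 0)) (h := fun v => v.get 0)
        (relRecursive_of_primrec ?_) (.get 0) (relRecursive_of_primrec ?_) ?_ ?_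
      · exact hg.comp (Primrec.vector_get.comp Primrec.id (Primrec.const 1))
          (Primrec.vector_get.comp Primrec.id (Primrec.const 0))
      · exact hd.comp (Primrec.vector_get.comp Primrec.id (Primrec.const 1))
          (Primrec.vector_get.comp Primrec.id (Primrec.const 0))
      · intro x y h
        exact (F_eq _ _).trans (if_neg h)
      · intro x y h
        exact (F_eq _ _).trans (if_pos h)
    refine (RelRecursive.comp
      (fun i v => if i = 0 then ordCode (stateNote (mu (p v)) (s v)) else p v) hF ?_ :)
    intro i
    refine relRecursive_of_primrec ?_
    by_cases hi : i = 0
    · simpa only [hi, if_true] using hcode.comp hp hs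
    · simpa only [hi, if_false] using hp

end Machine

/-! ### Arithmetic of ordinal notations -/

theorem primrec_ordCode : Primrec ordCode := Primrec.of_equiv (e := ordEquiv)

theorem primrec_ordDecode : Primrec ordDecode := Primrec.of_equiv_symm (e := ordEquiv)

theorem primrec_oadd :
    Primrec fun p : ONote × ℕ × ONote => ONote.oadd p.1 p.2.1.succPNat p.2.2 := by
  have h : Primrec fun p : ONote × ℕ × ONote =>
      ordDecode (Nat.pair (ordCode p.1) (Nat.pair p.2.1 (ordCode p.2.2)) + 1) := by
    refine primrec_ordDecode.comp (Primrec.succ.comp (Primrec₂.natPair.comp ?_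
      (Primrec₂.natPair.comp (Primrec.fst.comp Primrec.snd) ?_)))
    · exact primrec_ordCode.comp Primrec.fst
    · exact primrec_ordCode.comp (Primrec.snd.comp Primrec.snd)
  refine h.of_eq fun p => ?_
  rw [ordDecode]
  simp [ordDecode_ordCode]

theorem oadd_ne_zero {e n a} : ONote.oadd e n a ≠ 0 := nofun

/-- The leading exponent of an ordinal notation (`0` for `0`). -/
def oExp : ONote → ONote
  | ONote.zero => 0
  | ONote.oadd e _ _ => e

/-- The predecessor of the leading coefficient of an ordinal notation (`0` for `0`). -/
def oCoef : ONote → ℕ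
  | ONote.zero => 0
  | ONote.oadd _ n _ => n.natPred

/-- An ordinal notation without its leading term. -/
def oTail : ONote → ONote
  | ONote.zero => 0
  | ONote.oadd _ _ a => a

theorem primrec_oExp : Primrec oExp := by
  refine (primrec_ordDecode.comp (Primrec.fst.comp (Primrec.unpair.comp
    (Primrec.pred.comp primrec_ordCode)))).of_eq fun x => ?_
  cases x <;> simp [ordCode, oExp, ordDecode_ordCode, ordDecode]

theorem primrec_oCoef : Primrec oCoef := by
  refine (Primrec.fst.comp (Primrec.unpair.comp (Primrec.snd.comp (Primrec.unpair.comp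
    (Primrec.pred.comp primrec_ordCode))))).of_eq fun x => ?_
  cases x <;> simp [ordCode, oCoef]

theorem primrec_oTail : Primrec oTail := by
  refine (primrec_ordDecode.comp (Primrec.snd.comp (Primrec.unpair.comp (Primrec.snd.comp
    (Primrec.unpair.comp (Primrec.pred.comp primrec_ordCode)))))).of_eq fun x => ?_
  cases x <;> simp [ordCode, oTail, ordDecode_ordCode, ordDecode]

theorem ordCode_oExp_lt {x : ONote} (h : x ≠ 0) : ordCode (oExp x) < ordCode x := by
  cases x with
  | zero => exact absurd rfl h
  | oadd e n a => exact Nat.lt_succ_of_le (Nat.left_le_pair _ _)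

theorem ordCode_oTail_lt {x : ONote} (h : x ≠ 0) : ordCode (oTail x) < ordCode x := by
  cases x with
  | zero => exact absurd rfl h
  | oadd e n a =>
    exact Nat.lt_succ_of_le ((Nat.right_le_pair _ _).trans (Nat.right_le_pair _ _))

/-- The comparison of ordinal notations (correct for normal forms), as a Boolean function. -/
def oLt (x y : ONote) : Bool := x.cmp y == .lt

theorem cmp_self (x : ONote) : x.cmp x = .eq := by
  induction x with
  | zero => rfl
  | oadd e n a he ha => simp [ONote.cmp, he, ha]

/-- Both arguments become smaller in the recursive calls, so that this is a course-of-values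
recursion on the code of `y`. -/
theorem oLt_eq (x y : ONote) : oLt x y =
    if y = 0 then false else if x = 0 then true else
      oLt (oExp x) (oExp y) || (decide (oExp x = oExp y) &&
        (decide (oCoef x < oCoef y) ||
          (decide (oCoef x = oCoef y) && oLt (oTail x) (oTail y)))) := by
  cases x with
  | zero => cases y <;> simp [oLt, ONote.cmp, ← ONote.zero_def]
  | oadd e n a =>
    cases y with
    | zero => simp [oLt, ONote.cmp, ← ONote.zero_def]
    | oadd e' n' a' =>
      have hn : cmp (n : ℕ) n' = cmp n.natPred n'.natPred := by
        rw [← PNat.natPred_add_one n, ← PNat.natPred_add_one n']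
        simp [cmp, cmpUsing]
      rw [if_neg oadd_ne_zero, if_neg oadd_ne_zero]
      simp only [oLt, ONote.cmp, oExp, oCoef, oTail, hn]
      by_cases he : e = e'
      · subst he
        rcases lt_trichotomy n.natPred n'.natPred with h | h | h
        · simp [cmp_self, (cmp_eq_lt_iff _ _).2 h, h]
        · simp [cmp_self, h]
        · simp [cmp_self, (cmp_eq_gt_iff _ _).2 h, h.not_gt, h.ne']
      · cases hc : e.cmp e' with
        | lt => simp
        | eq => exact absurd (ONote.eq_of_cmp_eq hc) he
        | gt => simp [he]

theorem oLt_iff {x y : ONote} (hx : x.NF) (hy : y.NF) : oLt x y = true ↔ x < y := by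
  have := @ONote.cmp_compares x y hx hy
  cases h : x.cmp y <;> rw [h] at this <;> simp only [Ordering.Compares] at this
  · simp [oLt, h, this]
  · simp [oLt, this, cmp_self]
  · simpa [oLt, h] using fun h' => lt_asymm h' this

theorem primrec_oLt : Primrec₂ oLt := by
  refine Primrec.nat_omega_rec' (fun p : ONote × ONote => oLt p.1 p.2)
    (m := fun p => ordCode p.2)
    (l := fun p => if p.2 = 0 then [] else [(oExp p.1, oExp p.2), (oTail p.1, oTail p.2)])
    (g := fun p l => some (if p.2 = 0 then false else if p.1 = 0 then true else
      l.getD 0 false || (decide (oExp p.1 = oExp p.2) &&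
        (decide (oCoef p.1 < oCoef p.2) ||
          (decide (oCoef p.1 = oCoef p.2) && l.getD 1 false))))) ?_ ?_ ?_ ?_ ?_
  · exact primrec_ordCode.comp .snd
  · have h1 : Primrec fun p : ONote × ONote => (oExp p.1, oExp p.2) :=
      (primrec_oExp.comp .fst).pair (primrec_oExp.comp .snd)
    have h2 : Primrec fun p : ONote × ONote => (oTail p.1, oTail p.2) :=
      (primrec_oTail.comp .fst).pair (primrec_oTail.comp .snd)
    exact .ite (Primrec.eq.comp .snd (.const 0)) (.const [])
      (Primrec.list_cons.comp h1 (Primrec.list_cons.comp h2 (.const [])))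
  · have x : Primrec fun p : (ONote × ONote) × List Bool => p.1.1 := .comp .fst .fst
    have y : Primrec fun p : (ONote × ONote) × List Bool => p.1.2 := .comp .snd .fst
    have r (i : ℕ) : Primrec fun p : (ONote × ONote) × List Bool => p.2.getD i false :=
      (Primrec.list_getD false).comp .snd (.const i)
    exact Primrec.option_some.comp <| .ite (Primrec.eq.comp y (.const 0)) (.const false) <|
      .ite (Primrec.eq.comp x (.const 0)) (.const true) <| Primrec.or.comp (r 0) <|
      Primrec.and.comp (Primrec.eq.comp (primrec_oExp.comp x) (primrec_oExp.comp y)).decide <|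
      Primrec.or.comp
        (Primrec.nat_lt.comp (primrec_oCoef.comp x) (primrec_oCoef.comp y)).decide <|
      Primrec.and.comp
        (Primrec.eq.comp (primrec_oCoef.comp x) (primrec_oCoef.comp y)).decide (r 1)
  · rintro ⟨x, y⟩ b hb
    dsimp only at hb ⊢
    split_ifs at hb with h
    · simp at hb
    · simp only [List.mem_cons, List.not_mem_nil, or_false] at hb
      rcases hb with rfl | rfl
      · exact ordCode_oExp_lt h
      · exact ordCode_oTail_lt h
  · rintro ⟨x, y⟩
    dsimp only
    rw [oLt_eq x y]
    by_cases hy : y = 0 <;> simp [hy]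

theorem primrec_addAux : Primrec fun p : ONote × ℕ × ONote =>
    ONote.addAux p.1 p.2.1.succPNat p.2.2 := by
  have e : Primrec fun p : ONote × ℕ × ONote => p.1 := .fst
  have n : Primrec fun p : ONote × ℕ × ONote => p.2.1 := .comp .fst .snd
  have o : Primrec fun p : ONote × ℕ × ONote => p.2.2 := .comp .snd .snd
  have key : Primrec fun p : ONote × ℕ × ONote =>
      if p.2.2 = 0 then ONote.oadd p.1 p.2.1.succPNat 0
      else if oLt p.1 (oExp p.2.2) = true then p.2.2
      else if p.1 = oExp p.2.2 then
        ONote.oadd p.1 (p.2.1 + oCoef p.2.2 + 1).succPNat (oTail p.2.2)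
      else ONote.oadd p.1 p.2.1.succPNat p.2.2 := by
    refine .ite (Primrec.eq.comp o (.const 0)) (primrec_oadd.comp (e.pair (n.pair (.const 0)))) <|
      .ite (Primrec.eq.comp (primrec_oLt.comp e (primrec_oExp.comp o)) (.const true)) o <|
      .ite (Primrec.eq.comp e (primrec_oExp.comp o)) ?_ (primrec_oadd.comp (e.pair (n.pair o)))
    exact primrec_oadd.comp (e.pair ((Primrec.succ.comp (Primrec.nat_add.comp n
      (primrec_oCoef.comp o))).pair (primrec_oTail.comp o)))
  refine key.of_eq ?_
  rintro ⟨e, n, o⟩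
  cases o with
  | zero => rfl
  | oadd e' n' a' =>
    rw [if_neg oadd_ne_zero]
    simp only [ONote.addAux, oLt, oExp, oCoef, oTail]
    obtain hc | hc | hc : e.cmp e' = .lt ∨ e.cmp e' = .eq ∨ e.cmp e' = .gt := by
      cases e.cmp e' <;> simp
    · simp [hc]
    · obtain rfl := ONote.eq_of_cmp_eq hc
      simp only [cmp_self, ONote.oadd.injEq, true_and, and_true, reduceCtorEq, beq_iff_eq,
        if_true, if_false]
      rw [← PNat.coe_inj]
      have := PNat.natPred_add_one n'
      simp only [Nat.succPNat_coe, PNat.add_coe]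
      omega
    · have : e ≠ e' := by rintro rfl; simp [cmp_self] at hc
      simp [this, hc]

theorem primrec_add : Primrec₂ fun x y : ONote => x + y := by
  refine Primrec.nat_omega_rec' (fun p : ONote × ONote => p.1 + p.2)
    (m := fun p => ordCode p.1)
    (l := fun p => if p.1 = 0 then [] else [(oTail p.1, p.2)])
    (g := fun p l => some (if p.1 = 0 then p.2 else
      ONote.addAux (oExp p.1) (oCoef p.1).succPNat (l.getD 0 0))) ?_ ?_ ?_ ?_ ?_
  · exact primrec_ordCode.comp .fst
  · exact .ite (Primrec.eq.comp .fst (.const 0)) (.const [])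
      (Primrec.list_cons.comp ((primrec_oTail.comp .fst).pair .snd) (.const []))
  · have x : Primrec fun p : (ONote × ONote) × List ONote => p.1.1 := .comp .fst .fst
    have y : Primrec fun p : (ONote × ONote) × List ONote => p.1.2 := .comp .snd .fst
    exact Primrec.option_some.comp <| .ite (Primrec.eq.comp x (.const 0)) y <|
      primrec_addAux.comp ((primrec_oExp.comp x).pair ((primrec_oCoef.comp x).pair
        ((Primrec.list_getD 0).comp .snd (.const 0))))
  · rintro ⟨x, y⟩ b hb
    dsimp only at hb ⊢
    split_ifs at hb with h
    · simp at hb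
    · simp only [List.mem_cons, List.not_mem_nil, or_false] at hb
      rw [hb]
      exact ordCode_oTail_lt h
  · rintro ⟨x, y⟩
    cases x with
    | zero => simp
    | oadd e n a => simp [oExp, oCoef, oTail, ONote.oadd_add]

theorem sub_one_eq (x : ONote) : x - 1 =
    if oExp x = 0 then
      if oCoef x = 0 then oTail x else ONote.oadd 0 (oCoef x - 1).succPNat (oTail x)
    else x := by
  cases x with
  | zero => rfl
  | oadd e n a =>
    change ONote.sub _ (ONote.oadd 0 1 0) = _
    simp only [ONote.sub, oExp, oCoef, oTail]
    cases e with
    | zero =>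
      have := PNat.natPred_add_one n
      cases h : (n : ℕ) - 1 with
      | zero =>
        have hn : n = 1 := PNat.coe_inj.1 (by have := n.pos; rw [PNat.one_coe]; omega)
        subst hn
        have h1 : PNat.natPred 1 = 0 := rfl
        cases a <;> simp [ONote.cmp, ONote.sub, h1, ← ONote.zero_def]
      | succ k =>
        have hk : n.natPred = k + 1 := by omega
        simp [ONote.cmp, hk, h, ← ONote.zero_def]
    | oadd => simp [ONote.cmp, ← ONote.zero_def]

theorem primrec_split' : Primrec ONote.split' := by
  refine Primrec.nat_omega_rec' ONote.split'
    (m := ordCode)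
    (l := fun x => if x = 0 then [] else [oTail x])
    (g := fun x l => some (if x = 0 then (0, 0) else if oExp x = 0 then (0, oCoef x + 1) else
      (ONote.oadd (oExp x - 1) (oCoef x).succPNat (l.getD 0 (0, 0)).1, (l.getD 0 (0, 0)).2)))
      primrec_ordCode ?_ ?_ ?_ ?_
  · exact .ite (Primrec.eq.comp .id (.const 0)) (.const [])
      (Primrec.list_cons.comp primrec_oTail (.const []))
  · have hx : Primrec fun p : ONote × List (ONote × ℕ) => p.1 := .fst
    have hr : Primrec fun p : ONote × List (ONote × ℕ) => p.2.getD 0 (0, 0) :=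
      (Primrec.list_getD _).comp .snd (.const 0)
    have hs : Primrec fun x : ONote => x - 1 := by
      refine Primrec.of_eq ?_ fun x => (sub_one_eq x).symm
      refine .ite (Primrec.eq.comp primrec_oExp (.const 0))
        (.ite (Primrec.eq.comp primrec_oCoef (.const 0)) primrec_oTail ?_) .id
      exact primrec_oadd.comp ((Primrec.const 0).pair
        ((Primrec.pred.comp primrec_oCoef).pair primrec_oTail))
    exact Primrec.option_some.comp <| .ite (Primrec.eq.comp hx (.const 0)) (.const _) <|
      .ite (Primrec.eq.comp (primrec_oExp.comp hx) (.const 0))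
        ((Primrec.const 0).pair (Primrec.succ.comp (primrec_oCoef.comp hx))) <|
      (primrec_oadd.comp ((hs.comp (primrec_oExp.comp hx)).pair
        ((primrec_oCoef.comp hx).pair (Primrec.fst.comp hr)))).pair (Primrec.snd.comp hr)
  · intro x b hb
    split_ifs at hb with h
    · simp at hb
    · simp only [List.mem_cons, List.not_mem_nil, or_false] at hb
      rw [hb]
      exact ordCode_oTail_lt h
  · intro x
    cases x with
    | zero => simp [ONote.split']
    | oadd e n a =>
      by_cases he : e = 0 <;> simp [oExp, oCoef, oTail, ONote.split', he]

/-- A notation for `2 ^ x`: if `x` is `ω * a + m`, then `2 ^ x` is `ω ^ a * 2 ^ m`. -/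
def twoPow (x : ONote) : ONote := ONote.oadd x.split'.1 (2 ^ x.split'.2 - 1).succPNat 0

theorem primrec_twoPow : Primrec twoPow := by
  have h : Primrec fun n : ℕ => 2 ^ n :=
    (Primrec₂.unpaired'.1 Nat.Primrec.pow).comp (.const 2) .id
  exact primrec_oadd.comp ((Primrec.fst.comp primrec_split').pair
    ((Primrec.pred.comp (h.comp (Primrec.snd.comp primrec_split'))).pair (.const 0)))

theorem nf_twoPow {x : ONote} (hx : x.NF) : (twoPow x).NF := by
  have := (ONote.nf_repr_split' (o := x) rfl).1
  exact ONote.NF.oadd_zero _ _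

theorem repr_twoPow {x : ONote} (hx : x.NF) : (twoPow x).repr = 2 ^ x.repr := by
  have := (ONote.nf_repr_split' (o := x) rfl).2
  have h2 : (2 ^ x.split'.2 - 1 + 1 : ℕ) = 2 ^ x.split'.2 := Nat.sub_add_cancel Nat.one_le_two_pow
  have h3 : (2 : Ordinal.{0}) ^ ω = ω := natCast_opow_omega0 (n := 2) one_lt_two
  rw [this, opow_add, opow_mul, h3, twoPow, ONote.repr, ONote.repr_zero, add_zero, Nat.succPNat_coe,
    Nat.succ_eq_add_one, h2]
  simp

/-! ### Recursion on Gödel numbers of expressions -/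

section CodeRec

variable {α σ : Type}

/-- Course-of-values recursion on Gödel numbers. A number `n = ⟨t, x⟩` is read as an expression
with head symbol `t`, whose immediate subexpression is `x`, or whose immediate subexpressions are
the components of `x`. The value at `n` may depend on the values at these, for a parameter which
is changed by `up` below the binder `ε` (the symbol `6`), and on the value at `x` for the fixed
parameter `b`. -/
def codeRec (up : α → α) (b : α) (d : σ) (G : α × ℕ × ℕ → σ × σ × σ × σ → σ) (a : α) (n : ℕ) : σ :=
  if n.unpair.1 = 0 then G (a, n.unpair) (d, d, d, d)
  else
    G (a, n.unpair) (codeRec up b d G (if n.unpair.1 = 6 then up a else a) n.unpair.2,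
      codeRec up b d G a n.unpair.2.unpair.1, codeRec up b d G a n.unpair.2.unpair.2,
      codeRec up b d G b n.unpair.2)
termination_by n
decreasing_by
  all_goals
    have h1 : n.unpair.2 < n := by
      conv_rhs => rw [← Nat.pair_unpair n]
      have := Nat.add_le_pair n.unpair.1 n.unpair.2
      omega
    have h2 := Nat.unpair_left_le n.unpair.2
    have h3 := Nat.unpair_right_le n.unpair.2
    omega

theorem codeRec_pair (up : α → α) (b : α) (d : σ) (G : α × ℕ × ℕ → σ × σ × σ × σ → σ) (a : α)
    (t x : ℕ) : codeRec up b d G a (Nat.pair t x) =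
      if t = 0 then G (a, t, x) (d, d, d, d)
      else G (a, t, x) (codeRec up b d G (if t = 6 then up a else a) x,
        codeRec up b d G a x.unpair.1, codeRec up b d G a x.unpair.2, codeRec up b d G b x) := by
  rw [codeRec]
  simp only [Nat.unpair_pair]

theorem primrec_codeRec [Primcodable α] [Primcodable σ] {up : α → α} {b : α} {d : σ}
    {G : α × ℕ × ℕ → σ × σ × σ × σ → σ} (hup : Primrec up) (hG : Primrec₂ G) :
    Primrec₂ (codeRec up b d G) := by
  refine Primrec.nat_omega_rec' (fun p : α × ℕ => codeRec up b d G p.1 p.2)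
    (m := fun p => p.2)
    (l := fun p => if p.2.unpair.1 = 0 then [] else
      [(if p.2.unpair.1 = 6 then up p.1 else p.1, p.2.unpair.2), (p.1, p.2.unpair.2.unpair.1),
        (p.1, p.2.unpair.2.unpair.2), (b, p.2.unpair.2)])
    (g := fun p l => some (G (p.1, p.2.unpair)
      (l.getD 0 d, l.getD 1 d, l.getD 2 d, l.getD 3 d))) .snd ?_ ?_ ?_ ?_
  · have t : Primrec fun p : α × ℕ => p.2.unpair.1 := .comp .fst (.comp .unpair .snd)
    have x : Primrec fun p : α × ℕ => p.2.unpair.2 := .comp .snd (.comp .unpair .snd)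
    have a' : Primrec fun p : α × ℕ => if p.2.unpair.1 = 6 then up p.1 else p.1 :=
      .ite (Primrec.eq.comp t (.const 6)) (hup.comp .fst) .fst
    refine .ite (Primrec.eq.comp t (.const 0)) (.const []) ?_
    exact Primrec.list_cons.comp (a'.pair x) <| Primrec.list_cons.comp
      (Primrec.fst.pair (.comp .fst (.comp .unpair x))) <| Primrec.list_cons.comp
      (Primrec.fst.pair (.comp .snd (.comp .unpair x))) <| Primrec.list_cons.comp
      ((Primrec.const b).pair x) (.const [])
  · have r (i : ℕ) : Primrec fun p : (α × ℕ) × List σ => p.2.getD i d :=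
      (Primrec.list_getD d).comp .snd (.const i)
    exact Primrec.option_some.comp <| hG.comp
      ((Primrec.fst.comp .fst).pair (Primrec.unpair.comp (Primrec.snd.comp .fst)))
      ((r 0).pair ((r 1).pair ((r 2).pair (r 3))))
  · rintro ⟨a, n⟩ q hq
    dsimp only at hq ⊢
    split_ifs at hq with h h'
    · simp at hq
    all_goals
      have h1 : n.unpair.2 < n := by
        conv_rhs => rw [← Nat.pair_unpair n]
        have := Nat.add_le_pair n.unpair.1 n.unpair.2
        omega
      have h2 := Nat.unpair_left_le n.unpair.2
      have h3 := Nat.unpair_right_le n.unpair.2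
      simp only [List.mem_cons, List.not_mem_nil, or_false] at hq
      rcases hq with rfl | rfl | rfl | rfl <;> dsimp only <;> omega
  · rintro ⟨a, n⟩
    dsimp only
    conv_rhs => rw [codeRec]
    split_ifs <;> simp

/-- Case distinction by the arity of the head symbol `t`: variables, numerals and truth values,
symbols with one argument, the binder `ε`, and symbols with two arguments. -/
def tagCases (t : ℕ) (leaf unary binder binary : σ) : σ :=
  if t = 0 ∨ t = 1 ∨ t = 7 ∨ t = 8 then leaf
  else if t = 2 ∨ t = 11 then unary
  else if t = 6 then binder
  else binary

theorem primrec_tagCases [Primcodable α] [Primcodable σ] {t : α → ℕ} {f₁ f₂ f₃ f₄ : α → σ}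
    (ht : Primrec t) (h₁ : Primrec f₁) (h₂ : Primrec f₂) (h₃ : Primrec f₃) (h₄ : Primrec f₄) :
    Primrec fun a => tagCases (t a) (f₁ a) (f₂ a) (f₃ a) (f₄ a) := by
  have ht (i : ℕ) : PrimrecPred fun a => t a = i := Primrec.eq.comp ht (.const i)
  exact .ite ((ht 0).or ((ht 1).or ((ht 7).or (ht 8)))) h₁ <|
    .ite ((ht 2).or (ht 11)) h₂ <| .ite (ht 6) h₃ h₄

theorem codeRec_tagCases (up : α → α) (b : α) (d : σ) (l : α × ℕ × ℕ → σ) (u : α × ℕ × ℕ → σ → σ)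
    (e v : α × ℕ × ℕ → σ → σ → σ) (a : α) (t x : ℕ) {F : α → ℕ → σ}
    (hF : F = codeRec up b d fun p r =>
      tagCases p.2.1 (l p) (u p r.1) (e p r.1 r.2.2.2) (v p r.2.1 r.2.2.1)) :
    F a (Nat.pair t x) = tagCases t (l (a, t, x)) (u (a, t, x) (F a x))
      (e (a, t, x) (F (up a) x) (F b x)) (v (a, t, x) (F a x.unpair.1) (F a x.unpair.2)) := by
  subst hF
  rw [codeRec_pair]
  by_cases h0 : t = 0
  · simp [h0, tagCases]
  · by_cases h6 : t = 6 <;> simp [h0, h6, tagCases]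

end CodeRec

theorem code_injective : ∀ {s : Kind} (a b : Expr s), a.code = b.code → a = b := by
  intro s a
  induction a <;> intro b h <;> cases b <;> simp [Expr.code] at h ⊢ <;> grind

/-! ### Syntactic functions on Gödel numbers -/

/-- `Expr.closedAt` on Gödel numbers. -/
def closedAtC : ℕ → ℕ → Bool :=
  codeRec (· + 1) 0 false fun p r =>
    tagCases p.2.1 (decide (p.2.1 ≠ 0 ∨ p.2.2 < p.1)) r.1 r.1 (r.2.1 && r.2.2.1)

/-- `Expr.occurs` on Gödel numbers. -/
def occursC : ℕ → ℕ → Bool :=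
  codeRec (· + 1) 0 false fun p r =>
    tagCases p.2.1 (decide (p.2.1 = 0 ∧ p.2.2 = p.1)) r.1 r.1 (r.2.1 || r.2.2.1)

/-- `Expr.occRank` on Gödel numbers. -/
def occRankC : ℕ → ℕ → ℕ :=
  codeRec (· + 1) 0 0 fun p r =>
    tagCases p.2.1 0 r.1 (max (if occursC (p.1 + 1) p.2.2 = true then r.2.2.2 + 1 else 0) r.1)
      (max r.2.1 r.2.2.1)

/-- `Expr.rk` on Gödel numbers. -/
def rkC : ℕ → ℕ :=
  codeRec (fun _ => ()) () 0 (fun p r =>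
    tagCases p.2.1 0 r.1 (max (occRankC 0 p.2.2 + 1) r.1) (max r.2.1 r.2.2.1)) ()

/-- `Expr.closedEps` on Gödel numbers. -/
def closedEpsC : ℕ → List ℕ :=
  codeRec (fun _ => ()) () [] (fun p r =>
    tagCases p.2.1 [] r.1 ((if closedAtC 1 p.2.2 = true then [Nat.pair 6 p.2.2] else []) ++ r.1)
      (r.2.1 ++ r.2.2.1)) ()

section

variable {α σ : Type} [Primcodable α] [Primcodable σ]

/-! The arguments of the step function of `codeRec`: the parameter, the head symbol and the body of
an expression, and the values for its subexpressions. -/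

theorem primrec_arg₁ : Primrec fun p : (α × ℕ × ℕ) × σ × σ × σ × σ => p.1.1 :=
  .comp .fst .fst
theorem primrec_arg₂ : Primrec fun p : (α × ℕ × ℕ) × σ × σ × σ × σ => p.1.2.1 :=
  .comp .fst (.comp .snd .fst)
theorem primrec_arg₃ : Primrec fun p : (α × ℕ × ℕ) × σ × σ × σ × σ => p.1.2.2 :=
  .comp .snd (.comp .snd .fst)
theorem primrec_val₁ : Primrec fun p : (α × ℕ × ℕ) × σ × σ × σ × σ => p.2.1 :=
  .comp .fst .snd
theorem primrec_val₂ : Primrec fun p : (α × ℕ × ℕ) × σ × σ × σ × σ => p.2.2.1 :=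
  .comp .fst (.comp .snd .snd)
theorem primrec_val₃ : Primrec fun p : (α × ℕ × ℕ) × σ × σ × σ × σ => p.2.2.2.1 :=
  .comp .fst (.comp .snd (.comp .snd .snd))
theorem primrec_val₄ : Primrec fun p : (α × ℕ × ℕ) × σ × σ × σ × σ => p.2.2.2.2 :=
  .comp .snd (.comp .snd (.comp .snd .snd))

end

theorem primrec_closedAtC : Primrec₂ closedAtC :=
  primrec_codeRec Primrec.succ <| primrec_tagCases primrec_arg₂
    ((Primrec.eq.comp primrec_arg₂ (.const 0)).not.or
      (Primrec.nat_lt.comp primrec_arg₃ primrec_arg₁)).decide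
    primrec_val₁ primrec_val₁ (Primrec.and.comp primrec_val₂ primrec_val₃)

theorem primrec_occursC : Primrec₂ occursC :=
  primrec_codeRec Primrec.succ <| primrec_tagCases primrec_arg₂
    ((Primrec.eq.comp primrec_arg₂ (.const 0)).and
      (Primrec.eq.comp primrec_arg₃ primrec_arg₁)).decide
    primrec_val₁ primrec_val₁ (Primrec.or.comp primrec_val₂ primrec_val₃)

theorem primrec_occRankC : Primrec₂ occRankC :=
  primrec_codeRec Primrec.succ <| primrec_tagCases primrec_arg₂ (.const 0) primrec_val₁
    (Primrec.nat_max.comp (.ite (Primrec.eq.comp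
      (primrec_occursC.comp (Primrec.succ.comp primrec_arg₁) primrec_arg₃) (.const true))
      (Primrec.succ.comp primrec_val₄) (.const 0)) primrec_val₁)
    (Primrec.nat_max.comp primrec_val₂ primrec_val₃)

theorem primrec_rkC : Primrec rkC :=
  Primrec₂.comp (primrec_codeRec (.const ()) <| primrec_tagCases primrec_arg₂ (.const 0)
    primrec_val₁
    (Primrec.nat_max.comp (Primrec.succ.comp (primrec_occRankC.comp (.const 0) primrec_arg₃))
      primrec_val₁)
    (Primrec.nat_max.comp primrec_val₂ primrec_val₃)) (.const ()) .id

theorem primrec_closedEpsC : Primrec closedEpsC :=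
  Primrec₂.comp (primrec_codeRec (.const ()) <| primrec_tagCases primrec_arg₂ (.const [])
    primrec_val₁
    (Primrec.list_append.comp (.ite (Primrec.eq.comp
      (primrec_closedAtC.comp (.const 1) primrec_arg₃) (.const true))
      (Primrec.list_cons.comp (Primrec₂.natPair.comp (.const 6) primrec_arg₃) (.const []))
      (.const [])) primrec_val₁)
    (Primrec.list_append.comp primrec_val₂ primrec_val₃)) (.const ()) .id

theorem closedAtC_pair (k t x : ℕ) : closedAtC k (Nat.pair t x) =
    tagCases t (decide (t ≠ 0 ∨ x < k)) (closedAtC k x) (closedAtC (k + 1) x)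
      (closedAtC k x.unpair.1 && closedAtC k x.unpair.2) :=
  codeRec_tagCases (· + 1) 0 false (fun p => decide (p.2.1 ≠ 0 ∨ p.2.2 < p.1)) (fun _ r => r)
    (fun _ r _ => r) (fun _ r r' => r && r') k t x rfl

theorem occursC_pair (k t x : ℕ) : occursC k (Nat.pair t x) =
    tagCases t (decide (t = 0 ∧ x = k)) (occursC k x) (occursC (k + 1) x)
      (occursC k x.unpair.1 || occursC k x.unpair.2) :=
  codeRec_tagCases (· + 1) 0 false (fun p => decide (p.2.1 = 0 ∧ p.2.2 = p.1)) (fun _ r => r)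
    (fun _ r _ => r) (fun _ r r' => r || r') k t x rfl

theorem occRankC_pair (k t x : ℕ) : occRankC k (Nat.pair t x) =
    tagCases t 0 (occRankC k x)
      (max (if occursC (k + 1) x = true then occRankC 0 x + 1 else 0) (occRankC (k + 1) x))
      (max (occRankC k x.unpair.1) (occRankC k x.unpair.2)) :=
  codeRec_tagCases (· + 1) 0 0 (fun _ => 0) (fun _ r => r)
    (fun p r r' => max (if occursC (p.1 + 1) p.2.2 = true then r' + 1 else 0) r)
    (fun _ r r' => max r r') k t x rfl

theorem rkC_pair (t x : ℕ) : rkC (Nat.pair t x) =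
    tagCases t 0 (rkC x) (max (occRankC 0 x + 1) (rkC x))
      (max (rkC x.unpair.1) (rkC x.unpair.2)) :=
  codeRec_tagCases (fun _ => ()) () 0 (fun _ => 0) (fun _ r => r)
    (fun p r _ => max (occRankC 0 p.2.2 + 1) r) (fun _ r r' => max r r') () t x
    (F := fun _ => rkC) rfl

theorem closedEpsC_pair (t x : ℕ) : closedEpsC (Nat.pair t x) =
    tagCases t [] (closedEpsC x)
      ((if closedAtC 1 x = true then [Nat.pair 6 x] else []) ++ closedEpsC x)
      (closedEpsC x.unpair.1 ++ closedEpsC x.unpair.2) :=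
  codeRec_tagCases (fun _ => ()) () [] (fun _ => []) (fun _ r => r)
    (fun p r _ => (if closedAtC 1 p.2.2 = true then [Nat.pair 6 p.2.2] else []) ++ r)
    (fun _ r r' => r ++ r') () t x (F := fun _ => closedEpsC) rfl

theorem closedAtC_code {s : Kind} (e : Expr s) (k : ℕ) : closedAtC k e.code = e.closedAt k := by
  induction e generalizing k <;>
    simp [Expr.code, Expr.closedAt, closedAtC_pair, tagCases, *]

theorem occursC_code {s : Kind} (e : Expr s) (k : ℕ) : occursC k e.code = e.occurs k := by
  induction e generalizing k <;> simp [Expr.code, Expr.occurs, occursC_pair, tagCases, *]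

theorem occRankC_code {s : Kind} (e : Expr s) (k : ℕ) : occRankC k e.code = e.occRank k := by
  induction e generalizing k <;>
    simp [Expr.code, Expr.occRank, occRankC_pair, tagCases, occursC_code, *]

theorem rkC_code {s : Kind} (e : Expr s) : rkC e.code = e.rk := by
  induction e <;> simp [Expr.code, Expr.rk, rkC_pair, tagCases, occRankC_code, *]

theorem closedEpsC_code {s : Kind} (e : Expr s) :
    closedEpsC e.code = e.closedEps.map Expr.code := by
  induction e <;>
    simp [Expr.code, Expr.closedEps, closedEpsC_pair, tagCases, closedAtC_code, *]
  split_ifs <;> simp [Expr.code]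

/-! ### Reduction under an epsilon substitution on Gödel numbers -/

/-- An epsilon substitution with terms replaced by their Gödel numbers. -/
def substCode (S : Subst) : List (ℕ × ℕ) := S.map fun q => (q.1.code, q.2)

/-- `Subst.app` on Gödel numbers. -/
def appC (S : List (ℕ × ℕ)) (e : ℕ) : ℕ := (S.lookup e).getD 0

theorem primrec_appC : Primrec₂ appC :=
  Primrec.option_getD.comp (Primrec.listLookup.comp .snd .fst) (.const 0)

theorem appC_code (S : Subst) (e : Tm) : appC (substCode S) e.code = S.app e := by
  unfold appC Subst.app substCode
  congr 1
  induction S with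
  | nil => rfl
  | cons q S ih =>
    by_cases h : e = q.1
    · simp [List.lookup, h]
    · have h' : e.code ≠ q.1.code := fun h' => h (code_injective _ _ h')
      have h1 : (e == q.1) = false := by simpa using h
      have h2 : (e.code == q.1.code) = false := by simpa using h'
      simpa only [List.map_cons, List.lookup, h1, h2] using ih

/-- `Expr.ofBool` on Gödel numbers. -/
def ofBoolC (b : Bool) : ℕ := if b = true then Nat.pair 7 0 else Nat.pair 8 0

/-- Arguments `x` and `y` of a function symbol `t`, computed by `f` if both are numerals. -/
def evalFnC (f : ℕ → ℕ → ℕ) (t x y : ℕ) : ℕ :=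
  if x.unpair.1 = 1 ∧ y.unpair.1 = 1 then Nat.pair 1 (f x.unpair.2 y.unpair.2)
  else Nat.pair t (Nat.pair x y)

/-- Arguments `x` and `y` of a relation symbol `t`, computed by `f` if both are numerals. -/
def evalRelC (f : ℕ → ℕ → Bool) (t x y : ℕ) : ℕ :=
  if x.unpair.1 = 1 ∧ y.unpair.1 = 1 then ofBoolC (f x.unpair.2 y.unpair.2)
  else Nat.pair t (Nat.pair x y)

/-- Arguments `x` and `y` of a connective `t`, computed by `f` if both are truth values. -/
def evalConnC (f : Bool → Bool → Bool) (t x y : ℕ) : ℕ :=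
  if (x.unpair.1 = 7 ∨ x.unpair.1 = 8) ∧ (y.unpair.1 = 7 ∨ y.unpair.1 = 8) then
    ofBoolC (f (decide (x.unpair.1 = 7)) (decide (y.unpair.1 = 7)))
  else Nat.pair t (Nat.pair x y)

/-- The successor function and negation, computed at numerals and truth values. -/
def evalUnaryC (t x : ℕ) : ℕ :=
  if t = 2 then if x.unpair.1 = 1 then Nat.pair 1 (x.unpair.2 + 1) else Nat.pair 2 x
  else if x.unpair.1 = 7 ∨ x.unpair.1 = 8 then ofBoolC !decide (x.unpair.1 = 7)
  else Nat.pair 11 x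

/-- The binary symbols, computed at numerals and truth values. -/
def evalBinaryC (t x y : ℕ) : ℕ :=
  if t = 3 then evalFnC (fun m n => m + n) 3 x y
  else if t = 4 then evalFnC (fun m n => m * n) 4 x y
  else if t = 5 then evalFnC (fun m n => m - n) 5 x y
  else if t = 9 then evalRelC (fun m n => decide (m = n)) 9 x y
  else if t = 10 then evalRelC (fun m n => decide (m < n)) 10 x y
  else if t = 12 then evalConnC (fun a b => a && b) 12 x y
  else if t = 13 then evalConnC (fun a b => a || b) 13 x y
  else evalConnC (fun a b => !a || b) 14 x y

/-- `Subst.red` on Gödel numbers. -/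
def redC : List (ℕ × ℕ) → ℕ → ℕ :=
  codeRec id [] 0 fun p r =>
    tagCases p.2.1 (Nat.pair p.2.1 p.2.2) (evalUnaryC p.2.1 r.1)
      (if closedAtC 1 p.2.2 = true then Nat.pair 1 (appC p.1 (Nat.pair 6 r.1))
        else Nat.pair 6 r.1)
      (evalBinaryC p.2.1 r.2.1 r.2.2.1)

theorem redC_pair (S : List (ℕ × ℕ)) (t x : ℕ) : redC S (Nat.pair t x) =
    tagCases t (Nat.pair t x) (evalUnaryC t (redC S x))
      (if closedAtC 1 x = true then Nat.pair 1 (appC S (Nat.pair 6 (redC S x)))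
        else Nat.pair 6 (redC S x))
      (evalBinaryC t (redC S x.unpair.1) (redC S x.unpair.2)) :=
  codeRec_tagCases id [] 0 (fun p => Nat.pair p.2.1 p.2.2) (fun p r => evalUnaryC p.2.1 r)
    (fun p r _ => if closedAtC 1 p.2.2 = true then Nat.pair 1 (appC p.1 (Nat.pair 6 r))
        else Nat.pair 6 r) (fun p r r' => evalBinaryC p.2.1 r r') S t x rfl

section Primrec

variable {α : Type} [Primcodable α] {t x y : α → ℕ}

theorem primrec_head (hx : Primrec x) : Primrec fun a => (x a).unpair.1 :=
  .comp .fst (.comp .unpair hx)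

theorem primrec_body (hx : Primrec x) : Primrec fun a => (x a).unpair.2 :=
  .comp .snd (.comp .unpair hx)

theorem primrecPred_eq (hx : Primrec x) (i : ℕ) : PrimrecPred fun a => x a = i :=
  Primrec.eq.comp hx (.const i)

theorem primrec_ofBoolC : Primrec ofBoolC := Primrec.dom_bool _

theorem primrec_evalFnC {f : ℕ → ℕ → ℕ} (hf : Primrec₂ f) (t : ℕ) (hx : Primrec x)
    (hy : Primrec y) : Primrec fun a => evalFnC f t (x a) (y a) :=
  .ite ((primrecPred_eq (primrec_head hx) 1).and (primrecPred_eq (primrec_head hy) 1))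
    (Primrec₂.natPair.comp (.const 1) (hf.comp (primrec_body hx) (primrec_body hy)))
    (Primrec₂.natPair.comp (.const t) (Primrec₂.natPair.comp hx hy))

theorem primrec_evalRelC {f : ℕ → ℕ → Bool} (hf : Primrec₂ f) (t : ℕ) (hx : Primrec x)
    (hy : Primrec y) : Primrec fun a => evalRelC f t (x a) (y a) :=
  .ite ((primrecPred_eq (primrec_head hx) 1).and (primrecPred_eq (primrec_head hy) 1))
    (primrec_ofBoolC.comp (hf.comp (primrec_body hx) (primrec_body hy)))
    (Primrec₂.natPair.comp (.const t) (Primrec₂.natPair.comp hx hy))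

theorem primrec_evalConnC (f : Bool → Bool → Bool) (t : ℕ) (hx : Primrec x)
    (hy : Primrec y) : Primrec fun a => evalConnC f t (x a) (y a) :=
  have h {x : α → ℕ} (hx : Primrec x) (i : ℕ) := primrecPred_eq (primrec_head hx) i
  .ite (((h hx 7).or (h hx 8)).and ((h hy 7).or (h hy 8)))
    (primrec_ofBoolC.comp ((Primrec.dom_bool₂ f).comp (h hx 7).decide (h hy 7).decide))
    (Primrec₂.natPair.comp (.const t) (Primrec₂.natPair.comp hx hy))

theorem primrec_evalUnaryC (ht : Primrec t) (hx : Primrec x) :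
    Primrec fun a => evalUnaryC (t a) (x a) :=
  have h (i : ℕ) := primrecPred_eq (primrec_head hx) i
  .ite (primrecPred_eq ht 2)
    (.ite (h 1) (Primrec₂.natPair.comp (.const 1) (Primrec.succ.comp (primrec_body hx)))
      (Primrec₂.natPair.comp (.const 2) hx))
    (.ite ((h 7).or (h 8)) (primrec_ofBoolC.comp (Primrec.not.comp (h 7).decide))
      (Primrec₂.natPair.comp (.const 11) hx))

theorem primrec_evalBinaryC (ht : Primrec t) (hx : Primrec x) (hy : Primrec y) :
    Primrec fun a => evalBinaryC (t a) (x a) (y a) :=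
  .ite (primrecPred_eq ht 3) (primrec_evalFnC Primrec.nat_add 3 hx hy) <|
  .ite (primrecPred_eq ht 4) (primrec_evalFnC Primrec.nat_mul 4 hx hy) <|
  .ite (primrecPred_eq ht 5) (primrec_evalFnC Primrec.nat_sub 5 hx hy) <|
  .ite (primrecPred_eq ht 9) (primrec_evalRelC Primrec.eq.decide 9 hx hy) <|
  .ite (primrecPred_eq ht 10) (primrec_evalRelC Primrec.nat_lt.decide 10 hx hy) <|
  .ite (primrecPred_eq ht 12) (primrec_evalConnC _ 12 hx hy) <|
  .ite (primrecPred_eq ht 13) (primrec_evalConnC _ 13 hx hy) (primrec_evalConnC _ 14 hx hy)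

theorem primrec_redC : Primrec₂ redC := by
  refine primrec_codeRec .id <| primrec_tagCases primrec_arg₂
    (Primrec₂.natPair.comp primrec_arg₂ primrec_arg₃)
    (primrec_evalUnaryC primrec_arg₂ primrec_val₁)
    (.ite (Primrec.eq.comp (primrec_closedAtC.comp (.const 1) primrec_arg₃) (.const true)) ?_ ?_)
    (primrec_evalBinaryC primrec_arg₂ primrec_val₂ primrec_val₃)
  · exact Primrec₂.natPair.comp (.const 1)
      (primrec_appC.comp primrec_arg₁ (Primrec₂.natPair.comp (.const 6) primrec_val₁))
  · exact Primrec₂.natPair.comp (.const 6) primrec_val₁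

end Primrec

theorem evalFnC_code {c : Tm → Tm → Tm} {t : ℕ}
    (hc : ∀ a b, (c a b).code = Nat.pair t (Nat.pair a.code b.code)) (f : ℕ → ℕ → ℕ) (a b : Tm) :
    evalFnC f t a.code b.code = (Expr.evalFn c f a b).code := by
  cases a <;> cases b <;> simp [evalFnC, Expr.evalFn, hc] <;> simp [Expr.code]

theorem ofBoolC_eq (b : Bool) : ofBoolC b = (Expr.ofBool b).code := by
  cases b <;> rfl

theorem evalRelC_code {c : Tm → Tm → Fm} {t : ℕ}
    (hc : ∀ a b, (c a b).code = Nat.pair t (Nat.pair a.code b.code)) (f : ℕ → ℕ → Bool)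
    (a b : Tm) : evalRelC f t a.code b.code = (Expr.evalRel c f a b).code := by
  cases a <;> cases b <;> simp [evalRelC, Expr.evalRel, hc, ofBoolC_eq] <;> simp [Expr.code]

theorem evalConnC_code {c : Fm → Fm → Fm} {t : ℕ}
    (hc : ∀ a b, (c a b).code = Nat.pair t (Nat.pair a.code b.code)) (f : Bool → Bool → Bool)
    (a b : Fm) : evalConnC f t a.code b.code = (Expr.evalConn c f a b).code := by
  cases a <;> cases b <;> simp [evalConnC, Expr.evalConn, Expr.truth, hc, ofBoolC_eq] <;>
    simp [Expr.code]

theorem evalSucc_code (a : Tm) : evalUnaryC 2 a.code = (Expr.evalSucc a).code := by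
  cases a <;> simp [evalUnaryC, Expr.evalSucc] <;> simp [Expr.code]

theorem evalNeg_code (a : Fm) : evalUnaryC 11 a.code = (Expr.evalNeg a).code := by
  cases a <;> simp [evalUnaryC, Expr.evalNeg, Expr.truth, ofBoolC_eq] <;> simp [Expr.code]

theorem redC_code (S : Subst) {s : Kind} (e : Expr s) :
    redC (substCode S) e.code = (S.red e).code := by
  induction e with
  | eps F ih =>
    have h := appC_code S (.eps (S.red F))
    simp only [Expr.code] at h
    simp [Expr.code, redC_pair, tagCases, ih, Subst.red, closedAtC_code, h]
    split_ifs <;> simp [Expr.code]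
  | succ a ih => simp [Expr.code, redC_pair, tagCases, ih, Subst.red, evalSucc_code]
  | neg a ih => simp [Expr.code, redC_pair, tagCases, ih, Subst.red, evalNeg_code]
  | add a b iha ihb | mul a b iha ihb | monus a b iha ihb =>
    simp only [Expr.code, redC_pair, Nat.unpair_pair, iha, ihb, Subst.red]
    rw [← evalFnC_code (fun _ _ => by rw [Expr.code])]
    simp [tagCases, evalBinaryC]
  | eq a b iha ihb | lt a b iha ihb =>
    simp only [Expr.code, redC_pair, Nat.unpair_pair, iha, ihb, Subst.red]
    rw [← evalRelC_code (fun _ _ => by rw [Expr.code])]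
    simp [tagCases, evalBinaryC]
  | and a b iha ihb | or a b iha ihb | imp a b iha ihb =>
    simp only [Expr.code, redC_pair, Nat.unpair_pair, iha, ihb, Subst.red]
    rw [← evalConnC_code (fun _ _ => by rw [Expr.code])]
    simp [tagCases, evalBinaryC]
  | _ => simp [Expr.code, redC_pair, tagCases, Subst.red]

open HProc

/-! ### The H-process on Gödel numbers -/

/-- The Gödel numbers of the members of a sequence of epsilon axioms. -/
def critCodes (Cr : CritSeq) : List ℕ := Cr.map fun c => c.formula.code

/-- The list of Gödel numbers represented by the Gödel number of a sequence. -/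
def seqOf (c : ℕ) : List ℕ := (Encodable.decode c : Option (List ℕ)).getD []

theorem primrec_seqOf : Primrec seqOf := Primrec.option_getD.comp .decode (.const [])

theorem seqOf_code (Cr : CritSeq) : seqOf (CritSeq.code Cr) = critCodes Cr := by
  simp [seqOf, CritSeq.code, critCodes]

/-- The Gödel numbers in `ks` of the formulas that are not true under `S`. -/
def failing (ks : List ℕ) (S : List (ℕ × ℕ)) : List ℕ :=
  ks.filter fun m => decide (redC S m ≠ Nat.pair 7 0)

/-- For the Gödel number of `F[t] → ¬ t < εx.F ∧ F[εx.F]`, the pair `⟨t, εx.F⟩`. -/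
def ltArgs (m : ℕ) : ℕ := m.unpair.2.unpair.2.unpair.2.unpair.1.unpair.2.unpair.2

/-- `Expr.val` on Gödel numbers. -/
def valC (x : ℕ) : ℕ := if x.unpair.1 = 1 then x.unpair.2 else 0

/-- The substitution following `S` if the axiom with Gödel number `m` is the first false one. -/
def updateC (S : List (ℕ × ℕ)) (m : ℕ) : List (ℕ × ℕ) :=
  let e := Nat.pair 6 (redC S (ltArgs m).unpair.2.unpair.2)
  (e, valC (redC S (ltArgs m).unpair.1)) ::
    S.filter fun q => decide (rkC q.1 < rkC e ∨ (rkC q.1 = rkC e ∧ q.1 ≠ e))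

/-- `HProc.step` on Gödel numbers. -/
def stepC (ks : List ℕ) (S : List (ℕ × ℕ)) : List (ℕ × ℕ) :=
  ((failing ks S).head?.map (updateC S)).getD S

/-- `HProc.proc` on Gödel numbers. -/
def procC (ks : List ℕ) (n : ℕ) : List (ℕ × ℕ) := Nat.rec [] (fun _ S => stepC ks S) n

/-- Whether the `n`-th substitution of the H-process is solving. -/
def solvedC (ks : List ℕ) (n : ℕ) : Bool := decide (failing ks (procC ks n) = [])

/-- `HProc.r` on Gödel numbers. -/
def rC (ks : List ℕ) (n : ℕ) : ℕ :=
  if solvedC ks n = true then 0 else ((procC ks n).map fun q => rkC q.1).foldr max 0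

/-- `HProc.RANK` on Gödel numbers. -/
def rankC (ks : List ℕ) : ℕ := max ((ks.map rkC).foldr max 0 + 1) 2

/-- `HProc.closedTerms` on Gödel numbers. -/
def closedTermsC (ks : List ℕ) : List ℕ := (ks.flatMap closedEpsC).dedup

/-- `HProc.starts` on Gödel numbers. -/
def startsC (ks : List ℕ) (ξ m k : ℕ) : List ℕ :=
  m :: (List.range' (m + 1) (k - (m + 1))).filter fun i => decide (rC ks i = ξ)

section Primrec

variable {α : Type} [Primcodable α]

theorem primrec_failing : Primrec₂ failing := by
  have h : PrimrecRel fun (m : ℕ) (S : List (ℕ × ℕ)) => redC S m ≠ Nat.pair 7 0 :=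
    (Primrec.eq.comp (primrec_redC.comp .snd .fst) (.const (Nat.pair 7 0))).not
  exact h.listFilter

theorem primrec_ltArgs : Primrec ltArgs :=
  primrec_body <| primrec_body <| primrec_head <| primrec_body <| primrec_body <|
    primrec_body .id

theorem primrec_valC : Primrec valC :=
  .ite (primrecPred_eq (primrec_head .id) 1) (primrec_body .id) (.const 0)

theorem primrec_truncate : Primrec₂ fun (S : List (ℕ × ℕ)) (e : ℕ) =>
    S.filter fun q => decide (rkC q.1 < rkC e ∨ (rkC q.1 = rkC e ∧ q.1 ≠ e)) := by
  have h1 : Primrec fun p : (ℕ × ℕ) × ℕ => rkC p.1.1 := primrec_rkC.comp (.comp .fst .fst)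
  have h2 : Primrec fun p : (ℕ × ℕ) × ℕ => rkC p.2 := primrec_rkC.comp .snd
  have h3 : PrimrecPred fun p : (ℕ × ℕ) × ℕ => rkC p.1.1 < rkC p.2 := Primrec.nat_lt.comp h1 h2
  have h4 : PrimrecPred fun p : (ℕ × ℕ) × ℕ => rkC p.1.1 = rkC p.2 := Primrec.eq.comp h1 h2
  have h5 : PrimrecPred fun p : (ℕ × ℕ) × ℕ => p.1.1 = p.2 :=
    Primrec.eq.comp (.comp .fst .fst) .snd
  have hR : PrimrecRel fun (q : ℕ × ℕ) (e : ℕ) =>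
      rkC q.1 < rkC e ∨ (rkC q.1 = rkC e ∧ q.1 ≠ e) := h3.or (h4.and h5.not)
  exact hR.listFilter

theorem primrec_updateC : Primrec₂ updateC := by
  have ha : Primrec fun p : List (ℕ × ℕ) × ℕ => ltArgs p.2 := primrec_ltArgs.comp .snd
  have hS : Primrec fun p : List (ℕ × ℕ) × ℕ => p.1 := .fst
  have ht := primrec_redC.comp hS (primrec_head ha)
  have he := primrec_redC.comp hS (primrec_body (primrec_body ha))
  have he' := Primrec₂.natPair.comp (.const 6) he
  exact Primrec.list_cons.comp (he'.pair (primrec_valC.comp ht)) (primrec_truncate.comp hS he')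

theorem primrec_stepC : Primrec₂ stepC :=
  Primrec.option_getD.comp
    (Primrec.option_map (Primrec.list_head?.comp (primrec_failing.comp .fst .snd))
      (primrec_updateC.comp (.comp .snd .fst) .snd)) .snd

theorem primrec_procC : Primrec₂ procC :=
  Primrec.nat_rec (g := fun ks p => stepC ks p.2) (.const [])
    (primrec_stepC.comp .fst (.comp .snd .snd))

theorem primrec_solvedC : Primrec₂ solvedC :=
  (Primrec.eq.comp (primrec_failing.comp .fst primrec_procC) (.const [])).decide

theorem primrec_maxList {f : α → List ℕ} (hf : Primrec f) :
    Primrec fun a => (f a).foldr max 0 :=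
  Primrec.list_foldr (h := fun _ p => max p.1 p.2) hf (.const 0)
    (Primrec.nat_max.comp (.comp .fst .snd) (.comp .snd .snd))

theorem primrec_rC : Primrec₂ rC :=
  .ite (Primrec.eq.comp primrec_solvedC (.const true)) (.const 0)
    (primrec_maxList (Primrec.list_map primrec_procC (primrec_rkC.comp (.comp .fst .snd))))

theorem primrec_rankC : Primrec rankC :=
  Primrec.nat_max.comp (Primrec.succ.comp (primrec_maxList
    (Primrec.list_map .id (primrec_rkC.comp .snd)))) (.const 2)

theorem primrec_dedup : Primrec (List.dedup : List ℕ → List ℕ) := by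
  have hmem : PrimrecRel fun (a : ℕ) (l : List ℕ) => ∃ b ∈ l, b = a :=
    PrimrecRel.swap (PrimrecRel.exists_mem_list Primrec.eq)
  have h : Primrec fun l : List ℕ =>
      l.foldr (fun a l' => if ∃ b ∈ l', b = a then l' else a :: l') [] :=
    Primrec.list_foldr (h := fun _ p => if ∃ b ∈ p.2, b = p.1 then p.2 else p.1 :: p.2) .id
      (.const []) <|
      .ite (hmem.comp (.comp .fst .snd) (.comp .snd .snd)) (.comp .snd .snd)
        (Primrec.list_cons.comp (.comp .fst .snd) (.comp .snd .snd))
  refine h.of_eq fun l => ?_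
  induction l with
  | nil => rfl
  | cons a l ih =>
    rw [List.foldr_cons, ih]
    by_cases ha : a ∈ l
    · simp [List.dedup_cons_of_mem, ha]
    · simp [List.dedup_cons_of_notMem, ha]

theorem primrec_closedTermsC : Primrec closedTermsC :=
  primrec_dedup.comp (Primrec.list_flatMap .id (primrec_closedEpsC.comp .snd))

theorem primrec_filterRank : Primrec₂ fun (l : List ℕ) (p : List ℕ × ℕ) =>
    l.filter fun i => decide (rC p.1 i = p.2) := by
  have h1 : Primrec fun p : ℕ × List ℕ × ℕ => rC p.2.1 p.1 := primrec_rC.comp (.comp .fst .snd) .fst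
  have h2 : Primrec fun p : ℕ × List ℕ × ℕ => p.2.2 := .comp .snd .snd
  have hR : PrimrecRel fun (i : ℕ) (p : List ℕ × ℕ) => rC p.1 i = p.2 := Primrec.eq.comp h1 h2
  exact hR.listFilter

theorem primrec_range' {m k : α → ℕ} (hm : Primrec m) (hk : Primrec k) :
    Primrec fun a => List.range' (m a) (k a) := by
  have h1 : Primrec fun a => List.range (k a) := Primrec.list_range.comp hk
  have h2 : Primrec₂ fun a i => m a + i := Primrec.nat_add.comp (hm.comp .fst) .snd
  exact (Primrec.list_map h1 h2).of_eq fun a => (List.range'_eq_map_range ..).symm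

theorem primrec_startsC {ks : α → List ℕ} {ξ m k : α → ℕ} (hks : Primrec ks) (hξ : Primrec ξ)
    (hm : Primrec m) (hk : Primrec k) :
    Primrec fun a => startsC (ks a) (ξ a) (m a) (k a) := by
  have hm' := Primrec.succ.comp hm
  have h := primrec_filterRank.comp (primrec_range' hm' (Primrec.nat_sub.comp hk hm'))
    (hks.pair hξ)
  exact Primrec.list_cons.comp hm h

end Primrec

theorem redC_eq_top_iff (S : Subst) (F : Fm) :
    redC (substCode S) F.code = Nat.pair 7 0 ↔ S.red F = Expr.top := by
  rw [redC_code]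
  exact ⟨fun h => code_injective _ Expr.top h, fun h => by rw [h]; rfl⟩

theorem failing_critCodes (Cr : CritSeq) (S : Subst) : failing (critCodes Cr) (substCode S) =
    (Cr.filter fun c => decide (S.red c.formula ≠ Expr.top)).map fun c => c.formula.code := by
  simp only [failing, critCodes, List.filter_map, Function.comp_def, ne_eq, redC_eq_top_iff]

theorem valC_code (a : Tm) : valC a.code = a.val := by
  cases a <;> simp [valC, Expr.code, Expr.val]

theorem ltArgs_formula (c : CritAxiom) :
    ltArgs c.formula.code = Nat.pair c.t.code (Expr.eps c.F).code := by
  simp [ltArgs, CritAxiom.formula, Expr.code]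

theorem updateC_code (S : Subst) (c : CritAxiom) :
    updateC (substCode S) c.formula.code = substCode
      (let e : Tm := Expr.eps (S.red c.F)
       let v : ℕ := (S.red c.t).val
       (e, v) :: S.filter fun q => decide (q.1.rk < e.rk ∨ (q.1.rk = e.rk ∧ q.1 ≠ e))) := by
  have he : Nat.pair 6 (S.red c.F).code = (Expr.eps (S.red c.F)).code := by rw [Expr.code]
  have hF : (Expr.eps c.F).code.unpair.2 = c.F.code := by simp [Expr.code]
  have hinj (a b : Tm) : a.code = b.code ↔ a = b := ⟨code_injective a b, congrArg _⟩
  simp only [updateC, ltArgs_formula, Nat.unpair_pair, hF, redC_code, he, valC_code]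
  simp only [substCode, List.map_cons, List.filter_map, Function.comp_def, rkC_code, ne_eq, hinj]

theorem stepC_code (Cr : CritSeq) (S : Subst) :
    stepC (critCodes Cr) (substCode S) = substCode (step Cr S) := by
  rw [stepC, failing_critCodes, List.head?_map, List.head?_filter, step, falseAxiom]
  cases List.find? (fun c => decide (S.red c.formula ≠ Expr.top)) Cr with
  | none => rfl
  | some c => exact updateC_code S c

theorem procC_code (Cr : CritSeq) (n : ℕ) :
    procC (critCodes Cr) n = substCode (proc Cr n) := by
  induction n with
  | zero => rfl
  | succ n ih => exact (congrArg _ ih).trans (stepC_code Cr _)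

theorem solvedC_iff (Cr : CritSeq) (n : ℕ) :
    solvedC (critCodes Cr) n = true ↔ Solving Cr (proc Cr n) := by
  simp [solvedC, procC_code, failing_critCodes, Solving]

theorem rC_code (Cr : CritSeq) (n : ℕ) : rC (critCodes Cr) n = r Cr n := by
  simp only [rC, solvedC_iff, r, Subst.rk, procC_code, substCode, List.map_map, Function.comp_def,
    rkC_code]

theorem rankC_code (Cr : CritSeq) : rankC (critCodes Cr) = RANK Cr := by
  simp only [rankC, RANK, critCodes, List.map_map, Function.comp_def, rkC_code]

theorem closedTermsC_code (Cr : CritSeq) :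
    closedTermsC (critCodes Cr) = (closedTerms Cr).map Expr.code := by
  have hinj : Function.Injective (Expr.code : Tm → ℕ) := fun a b => code_injective a b
  simp only [closedTermsC, closedTerms, ← List.dedup_map_of_injective hinj, critCodes,
    List.flatMap_map, closedEpsC_code, List.map_flatMap]

theorem startsC_code (Cr : CritSeq) (ξ m k : ℕ) :
    startsC (critCodes Cr) ξ m k = starts Cr ξ m k := by
  simp only [startsC, starts, rC_code]

/-! ### Notations for the ordinals of the H-process -/

/-- A notation for `(ω + 1) ^ i = ω ^ i + ⋯ + ω + 1`. -/
def powNote : ℕ → ONote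
  | 0 => 1
  | i + 1 => ONote.oadd (ONote.ofNat (i + 1)) 1 (powNote i)

theorem nfBelow_powNote (i : ℕ) : (powNote i).NFBelow (i + 1) := by
  induction i with
  | zero => exact ONote.NFBelow.oadd .zero .zero (by simp)
  | succ i ih =>
    refine ONote.NFBelow.oadd (ONote.nf_ofNat _) ?_ ?_
    · simpa using ih
    · simp

instance (i : ℕ) : (powNote i).NF := ⟨_, nfBelow_powNote i⟩

theorem powNote_eq (i : ℕ) :
    powNote i = ONote.oadd (ONote.ofNat i) 1 (oTail (powNote i)) := by
  cases i <;> rfl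

theorem repr_powNote_mul_omega (i : ℕ) :
    (powNote i).repr * ω = ω ^ ((i + 1 : ℕ) : Ordinal.{0}) := by
  have : ONote.omega.NF := ONote.NF.oadd_zero _ _
  have h : ONote.omega.repr = ω := by simp [ONote.omega]
  rw [← h, ← ONote.repr_mul, powNote_eq, ONote.omega, ONote.oadd_mul, if_neg (by decide), mul_zero,
    ONote.repr, ONote.repr_add]
  simp

theorem repr_powNote (i : ℕ) : (powNote i).repr = (ω + 1) ^ (i : Ordinal.{0}) := by
  induction i with
  | zero => simp [powNote]
  | succ i ih =>
    have h := repr_powNote_mul_omega i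
    rw [ih] at h
    rw [Nat.cast_succ, opow_add, opow_one, mul_add, mul_one, h, ← ih, powNote, ONote.repr]
    simp

/-- A notation for `(ω + 1) ^ i * φ`, where `φ` is the order type of `v` in the Ackermann
ordering. -/
def termNote (i v : ℕ) : ONote :=
  if v = 0 then ONote.oadd (ONote.ofNat (i + 1)) 1 0
  else if v = 1 then 0
  -- A finite right factor `v - 1` only affects the leading coefficient, which is `1` in
  -- `(ω + 1) ^ i`; `succPNat` adds the remaining `1`.
  else ONote.oadd (ONote.ofNat i) (v - 2).succPNat (oTail (powNote i))

theorem nf_repr_termNote (i v : ℕ) :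
    (termNote i v).NF ∧ (termNote i v).repr = (ω + 1) ^ (i : Ordinal.{0}) * ackType v := by
  rw [termNote, ackType, ← repr_powNote]
  split_ifs with h0 h1
  · refine ⟨ONote.NF.oadd_zero _ _, ?_⟩
    rw [repr_powNote_mul_omega, ONote.repr, ONote.repr_ofNat]
    simp
  · exact ⟨.zero, by simp [h1]⟩
  · have h : ONote.oadd (ONote.ofNat i) (v - 2).succPNat (oTail (powNote i)) =
        powNote i * ONote.ofNat (v - 1) := by
      conv_rhs => rw [powNote_eq, show v - 1 = (v - 2) + 1 by omega]
      rw [ONote.ofNat_succ, ONote.oadd_mul, if_pos rfl, one_mul]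
    rw [h]
    exact ⟨inferInstance, by rw [ONote.repr_mul, ONote.repr_ofNat]⟩

theorem primrec_ofNat : Primrec ONote.ofNat := by
  refine (Primrec.nat_casesOn .id (.const 0) (h := fun _ n => ONote.oadd 0 n.succPNat 0)
    (primrec_oadd.comp ((Primrec.const 0).pair (Primrec.snd.pair (.const 0))))).of_eq fun n => ?_
  cases n <;> rfl

theorem primrec_powNote : Primrec powNote := by
  have h : Primrec₂ fun (_ : ℕ) (p : ℕ × ONote) =>
      ONote.oadd (ONote.ofNat (p.1 + 1)) (Nat.succPNat 0) p.2 :=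
    primrec_oadd.comp ((primrec_ofNat.comp (Primrec.succ.comp (.comp .fst .snd))).pair
      ((Primrec.const 0).pair (.comp .snd .snd)))
  refine (Primrec.nat_rec' .id (.const 1) h).of_eq fun n => ?_
  induction n with
  | zero => rfl
  | succ n ih => exact congrArg (ONote.oadd _ _) ih

theorem primrec_termNote : Primrec₂ termNote := by
  have hi : Primrec fun p : ℕ × ℕ => ONote.ofNat p.1 := primrec_ofNat.comp .fst
  have hi' : Primrec fun p : ℕ × ℕ => ONote.ofNat (p.1 + 1) :=
    primrec_ofNat.comp (Primrec.succ.comp .fst)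
  have hv : Primrec fun p : ℕ × ℕ => p.2 - 2 := Primrec.nat_sub.comp .snd (.const 2)
  have ht : Primrec fun p : ℕ × ℕ => oTail (powNote p.1) :=
    primrec_oTail.comp (primrec_powNote.comp .fst)
  exact .ite (primrecPred_eq .snd 0)
    (primrec_oadd.comp (hi'.pair ((Primrec.const 0).pair (.const 0)))) <|
    .ite (primrecPred_eq .snd 1) (.const 0) (primrec_oadd.comp (hi.pair (hv.pair ht)))

/-- A notation for `ind`, on Gödel numbers. The terms are added from the left, beginning with that
of lowest degree; the first component counts them. -/
def indNote (ks : List ℕ) (S : List (ℕ × ℕ)) : ONote :=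
  ((closedTermsC ks).foldl
    (fun p e => (p.1 + 1, termNote p.1 (valC (redC S e)) + p.2)) ((0, 0) : ℕ × ONote)).2

theorem primrec_indNote : Primrec₂ indNote := by
  have hv : Primrec fun p : (List ℕ × List (ℕ × ℕ)) × (ℕ × ONote) × ℕ =>
      valC (redC p.1.2 p.2.2) :=
    primrec_valC.comp (primrec_redC.comp (.comp .snd .fst) (.comp .snd .snd))
  have hi : Primrec fun p : (List ℕ × List (ℕ × ℕ)) × (ℕ × ONote) × ℕ => p.2.1.1 :=
    .comp .fst (.comp .fst .snd)
  have ho : Primrec fun p : (List ℕ × List (ℕ × ℕ)) × (ℕ × ONote) × ℕ => p.2.1.2 :=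
    .comp .snd (.comp .fst .snd)
  have h := (Primrec.succ.comp hi).pair (primrec_add.comp (primrec_termNote.comp hi hv) ho)
  exact Primrec.snd.comp
    (Primrec.list_foldl (primrec_closedTermsC.comp .fst) (.const (0, 0)) h.to₂)

theorem nf_repr_indNote (Cr : CritSeq) (S : Subst) :
    (indNote (critCodes Cr) (substCode S)).NF ∧
      (indNote (critCodes Cr) (substCode S)).repr = ind Cr S := by
  have key : ∀ (l : List Tm) (i : ℕ) (x : ONote), x.NF →
      let y := ((l.map Expr.code).foldl
        (fun p e => (p.1 + 1, termNote p.1 (valC (redC (substCode S) e)) + p.2)) (i, x)).2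
      y.NF ∧ y.repr = ((((l.zipIdx i).map fun q =>
        (ω + 1) ^ (q.2 : Ordinal.{0}) * ackType (S.red q.1).val).reverse).sum + x.repr) := by
    intro l
    induction l with
    | nil => intro i x hx; simpa using hx
    | cons e l ih =>
      intro i x hx
      have ht := nf_repr_termNote i (S.red e).val
      have := ht.1
      obtain ⟨h1, h2⟩ := ih (i + 1) (termNote i (S.red e).val + x) inferInstance
      simp only [List.map_cons, List.foldl_cons, List.zipIdx_cons, List.reverse_cons,
        List.sum_append, List.sum_singleton, redC_code, valC_code] at h1 h2 ⊢
      refine ⟨h1, h2.trans ?_⟩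
      rw [ONote.repr_add, ht.2, add_assoc]
  have := key (closedTerms Cr) 0 0 ONote.NF.zero
  simpa [indNote, ind, closedTermsC_code] using this

/-- A notation for `HProc.a`, on Gödel numbers. -/
def aNote (ks : List ℕ) (n : ℕ) : ONote :=
  if solvedC ks n = true then 0 else indNote ks (procC ks n)

theorem primrec_aNote : Primrec₂ aNote :=
  .ite (Primrec.eq.comp primrec_solvedC (.const true)) (.const 0)
    (primrec_indNote.comp .fst primrec_procC)

theorem nf_repr_aNote (Cr : CritSeq) (n : ℕ) :
    (aNote (critCodes Cr) n).NF ∧ (aNote (critCodes Cr) n).repr = a Cr n := by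
  by_cases h : Solving Cr (proc Cr n)
  · simp only [aNote, a, solvedC_iff, h, if_true]
    exact ⟨.zero, rfl⟩
  · simp only [aNote, a, solvedC_iff, h, if_false, procC_code]
    exact nf_repr_indNote _ _

/-- The pairs of consecutive elements of the list `ks` continued by `k`. -/
def intervals (ks : List ℕ) (k : ℕ) : List (ℕ × ℕ) := ks.zip (ks.tail ++ [k])

theorem primrec_intervals : Primrec₂ intervals := by
  have h : Primrec fun p : (List ℕ × ℕ) × ℕ × ℕ × List (ℕ × ℕ) =>
      (p.2.1, (p.2.1, p.2.2.1) :: p.2.2.2) := by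
    have hb : Primrec fun p : (List ℕ × ℕ) × ℕ × ℕ × List (ℕ × ℕ) => p.2.1 := .comp .fst .snd
    have hc : Primrec fun p : (List ℕ × ℕ) × ℕ × ℕ × List (ℕ × ℕ) => p.2.2.1 :=
      .comp .fst (.comp .snd .snd)
    have hl : Primrec fun p : (List ℕ × ℕ) × ℕ × ℕ × List (ℕ × ℕ) => p.2.2.2 :=
      .comp .snd (.comp .snd .snd)
    exact hb.pair (Primrec.list_cons.comp (hb.pair hc) hl)
  have h' : Primrec fun p : List ℕ × ℕ =>
      (p.1.foldr (fun b q => (b, (b, q.1) :: q.2)) ((p.2, []) : ℕ × List (ℕ × ℕ))).2 :=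
    Primrec.snd.comp (Primrec.list_foldr .fst (Primrec.snd.pair (.const [])) h.to₂)
  refine h'.of_eq fun p => ?_
  obtain ⟨ks, k⟩ := p
  suffices ks.foldr (fun b q => (b, (b, q.1) :: q.2)) ((k, []) : ℕ × List (ℕ × ℕ)) =
      (ks.headD k, intervals ks k) by rw [this]
  induction ks with
  | nil => rfl
  | cons b ks ih =>
    rw [List.foldr_cons, ih]
    cases ks <;> rfl

/-- A notation for `HProc.oAux`, on Gödel numbers. -/
def oNote (ks : List ℕ) : ℕ → ℕ → ℕ → ONote
  | 0, m, _ => aNote ks m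
  | j + 1, m, k => ((intervals (startsC ks (rankC ks - (j + 1)) m k) k).map fun q =>
      twoPow (oNote ks j q.1 q.2)).foldr (· + ·) 0

theorem primrec_oNote :
    Primrec fun p : (List ℕ × ℕ) × ℕ × ℕ => oNote p.1.1 p.1.2 p.2.1 p.2.2 := by
  have hks : Primrec fun p : (List ℕ × ℕ) × ℕ × ℕ => p.1.1 := .comp .fst .fst
  have hj : Primrec fun p : (List ℕ × ℕ) × ℕ × ℕ => p.1.2 := .comp .snd .fst
  have hm : Primrec fun p : (List ℕ × ℕ) × ℕ × ℕ => p.2.1 := .comp .fst .snd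
  have hk : Primrec fun p : (List ℕ × ℕ) × ℕ × ℕ => p.2.2 := .comp .snd .snd
  have hs := primrec_intervals.comp
    (primrec_startsC hks (Primrec.nat_sub.comp (primrec_rankC.comp hks) hj) hm hk) hk
  refine Primrec.nat_omega_rec' _ (m := fun p => p.1.2)
    (l := fun p => if p.1.2 = 0 then [] else
      (intervals (startsC p.1.1 (rankC p.1.1 - p.1.2) p.2.1 p.2.2) p.2.2).map
        fun q => ((p.1.1, p.1.2 - 1), q))
    (g := fun p l => some (if p.1.2 = 0 then aNote p.1.1 p.2.1 else
      (l.map twoPow).foldr (· + ·) 0)) hj ?_ ?_ ?_ ?_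
  · have hp : Primrec₂ fun (p : (List ℕ × ℕ) × ℕ × ℕ) (q : ℕ × ℕ) => ((p.1.1, p.1.2 - 1), q) :=
      (((hks.comp .fst).pair (Primrec.pred.comp (hj.comp .fst))).pair .snd).to₂
    exact .ite (primrecPred_eq hj 0) (.const []) (Primrec.list_map hs hp)
  · have ha : Primrec fun p : ((List ℕ × ℕ) × ℕ × ℕ) × List ONote => aNote p.1.1.1 p.1.2.1 :=
      primrec_aNote.comp (hks.comp .fst) (hm.comp .fst)
    have hl : Primrec fun p : ((List ℕ × ℕ) × ℕ × ℕ) × List ONote => p.2.map twoPow :=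
      Primrec.list_map .snd (primrec_twoPow.comp .snd)
    have hsum : Primrec₂ fun (_ : ((List ℕ × ℕ) × ℕ × ℕ) × List ONote) (q : ONote × ONote) =>
      q.1 + q.2 := primrec_add.comp (.comp .fst .snd) (.comp .snd .snd)
    exact Primrec.option_some.comp <| .ite (primrecPred_eq (hj.comp .fst) 0) ha
      (Primrec.list_foldr hl (.const 0) hsum)
  · rintro ⟨⟨ks, j⟩, m, k⟩ b hb
    dsimp only at hb ⊢
    split_ifs at hb with h
    · simp at hb
    · simp only [List.mem_map] at hb
      obtain ⟨q, -, rfl⟩ := hb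
      dsimp only
      omega
  · rintro ⟨⟨ks, j⟩, m, k⟩
    cases j with
    | zero => simp [oNote]
    | succ j => simp [oNote, List.map_map, Function.comp_def]

theorem nf_repr_oNote (Cr : CritSeq) (j m k : ℕ) :
    (oNote (critCodes Cr) j m k).NF ∧ (oNote (critCodes Cr) j m k).repr = oAux Cr j m k := by
  induction j generalizing m k with
  | zero => exact nf_repr_aNote Cr m
  | succ j ih =>
    have key (l : List (ℕ × ℕ)) :
        let y := (l.map fun q => twoPow (oNote (critCodes Cr) j q.1 q.2)).foldr (· + ·) 0
        y.NF ∧ y.repr = (l.map fun q => 2 ^ oAux Cr j q.1 q.2).sum := by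
      induction l with
      | nil => exact ⟨.zero, rfl⟩
      | cons q l ihl =>
        dsimp only at ihl
        obtain ⟨h1, h2⟩ := ihl
        obtain ⟨h3, h4⟩ := ih q.1 q.2
        have h5 := nf_twoPow h3
        simp only [List.map_cons, List.foldr_cons, List.sum_cons]
        refine ⟨ONote.add_nf _ _, ?_⟩
        rw [ONote.repr_add, h2, repr_twoPow h3, h4]
    have := key (intervals (startsC (critCodes Cr) (rankC (critCodes Cr) - (j + 1)) m k) k)
    refine ⟨this.1, this.2.trans ?_⟩
    simp only [startsC_code, rankC_code, intervals, oAux, List.zip, List.map_zipWith]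

/-! ### A bound on the ordinals of the H-process -/

/-- The tower of exponentials with base `ω` above `ω ^ ω`. -/
def tower : ℕ → ONote
  | 0 => ONote.oadd ONote.omega 1 0
  | j + 1 => ONote.oadd (tower j) 1 0

instance nf_tower (j : ℕ) : (tower j).NF := by
  induction j with
  | zero => exact ONote.NF.oadd_zero _ _ (h := ONote.NF.oadd_zero _ _)
  | succ j ih => exact ONote.NF.oadd_zero _ _

theorem repr_tower_zero : (tower 0).repr = ω ^ ω := by simp [tower, ONote.omega]

theorem repr_tower_succ (j : ℕ) : (tower (j + 1)).repr = ω ^ (tower j).repr := by simp [tower]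

theorem primrec_tower : Primrec tower := by
  have h : Primrec₂ fun (_ : ℕ) (p : ℕ × ONote) => ONote.oadd p.2 (Nat.succPNat 0) 0 :=
    primrec_oadd.comp ((Primrec.snd.comp .snd).pair ((Primrec.const 0).pair (.const 0)))
  refine (Primrec.nat_rec' .id (.const (tower 0)) h).of_eq fun n => ?_
  induction n with
  | zero => rfl
  | succ n ih => exact congrArg (ONote.oadd · 1 0) ih

theorem tower_lt_succ (j : ℕ) : (tower j).repr < (tower (j + 1)).repr := by
  induction j with
  | zero =>
    rw [repr_tower_succ, repr_tower_zero]
    exact (opow_lt_opow_iff_right one_lt_omega0).2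
      ((opow_one ω).symm.trans_lt ((opow_lt_opow_iff_right one_lt_omega0).2 one_lt_omega0))
  | succ j ih =>
    rw [repr_tower_succ (j + 1), repr_tower_succ j]
    rw [repr_tower_succ j] at ih
    exact (opow_lt_opow_iff_right one_lt_omega0).2 ih

theorem sum_lt_omega0_opow {l : List Ordinal.{0}} {x : Ordinal.{0}} (h : ∀ y ∈ l, y < ω ^ x) :
    l.sum < ω ^ x := by
  induction l with
  | nil => exact opow_pos _ omega0_pos
  | cons y l ih =>
    rw [List.sum_cons]
    exact isPrincipal_add_omega0_opow x (h y (by simp)) (ih fun z hz => h z (by simp [hz]))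

theorem ind_lt (Cr : CritSeq) (S : Subst) : ind Cr S < ω ^ ω := by
  refine sum_lt_omega0_opow fun y hy => ?_
  simp only [List.mem_reverse, List.mem_map] at hy
  obtain ⟨q, -, rfl⟩ := hy
  have h : ackType (S.red q.1).val ≤ ω := by
    rw [ackType]
    split_ifs
    · exact le_rfl
    · exact (natCast_lt_omega0 _).le
  refine (mul_le_mul_right h _).trans_lt ?_
  rw [← repr_powNote, repr_powNote_mul_omega]
  exact (opow_lt_opow_iff_right one_lt_omega0).2 (natCast_lt_omega0 _)

theorem oAux_lt_tower (Cr : CritSeq) (j m k : ℕ) : oAux Cr j m k < (tower j).repr := by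
  induction j generalizing m k with
  | zero =>
    rw [repr_tower_zero, oAux, a]
    split_ifs
    · exact opow_pos _ omega0_pos
    · exact ind_lt _ _
  | succ j ih =>
    rw [repr_tower_succ, oAux]
    refine sum_lt_omega0_opow fun y hy => ?_
    rw [← List.map_uncurry_zip_eq_zipWith] at hy
    simp only [List.mem_map] at hy
    obtain ⟨q, -, rfl⟩ := hy
    exact (opow_le_opow_left _ (natCast_lt_omega0 2).le).trans_lt
      ((opow_lt_opow_iff_right one_lt_omega0).2 (ih _ _))

/-! ### A stack machine for the function `M` -/

/-- A pending task `(i, q, n, m)` of the computation of `M`, which receives a value `v`: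
for `i = 0`, to compute `M(q, v)`; for `i = 1`, to compute `M(q + 1, n)`, where `v` is `M(q, n)`;
otherwise, to compute `M(q + 1, n)`, where `m` is `M(q, n)` and `v` is `M(q, m)`. -/
abbrev Frame := ℕ × ℕ × ℕ × ℕ

/-- The result of giving the value `v` to a task: a new value, together with the tasks which have
to receive it, and successively one another's results, in order to complete the given task. -/
def exec (ks : List ℕ) (v : ℕ) (f : Frame) : ℕ × List Frame :=
  if f.1 = 0 then
    if f.2.1 = 0 then (v + 1, [])
    else if solvedC ks v = true then (v, [])
    else (v, [(0, f.2.1 - 1, 0, 0), (1, f.2.1 - 1, v, 0)])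
  else if f.1 = 1 then (v, [(0, f.2.1, 0, 0), (2, f.2.1, f.2.2.1, v)])
  else if oLt (oNote ks (rankC ks) f.2.2.2 v) (oNote ks (rankC ks) f.2.2.1 f.2.2.2) = true ∧
      ¬ rC ks f.2.2.2 < rC ks f.2.2.1 ∧ ¬ solvedC ks f.2.2.2 = true then
    (v, [(0, f.2.1, 0, 0), (2, f.2.1, f.2.2.2, v)])
  else (f.2.2.2, [])

/-- One step of the machine, whose states consist of a value and a stack of tasks. -/
def next (ks : List ℕ) (s : ℕ × List Frame) : ℕ × List Frame :=
  (s.2.head?.map fun f => ((exec ks s.1 f).1, (exec ks s.1 f).2 ++ s.2.tail)).getD s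

/-- The exponent `ω ^ γ * (q + 1) + w` of a task of level `q`, where `γ = ω ^ tower R` for the rank
`R`. The ordinals `o` are smaller than `tower R`. The summand `w` is `0` before the computation of
`M(q, v)`. In a loop it is `ω ^ tower R` as long as no ordinal `e_q(n)` is known, and `ω ^ e_q(n)`
after that. -/
def expo (ks : List ℕ) (f : Frame) : ONote :=
  ONote.oadd (tower (rankC ks + 1)) f.2.1.succPNat
    (if f.1 = 0 then 0
    else if f.1 = 1 then tower (rankC ks + 1)
    else ONote.oadd (oNote ks (rankC ks) f.2.2.1 f.2.2.2) 1 0)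

/-- The sum of the powers of `ω` with the exponents of the tasks of a stack. The exponents decrease
towards the top of the stack. -/
def measure (ks : List ℕ) (K : List Frame) : ONote :=
  K.foldl (fun x f => ONote.oadd (expo ks f) 1 x) 0

section Primrec

theorem primrec_exec : Primrec fun p : (List ℕ × ℕ) × Frame => exec p.1.1 p.1.2 p.2 := by
  have ks : Primrec fun p : (List ℕ × ℕ) × Frame => p.1.1 := .comp .fst .fst
  have v : Primrec fun p : (List ℕ × ℕ) × Frame => p.1.2 := .comp .snd .fst
  have i : Primrec fun p : (List ℕ × ℕ) × Frame => p.2.1 := .comp .fst .snd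
  have q : Primrec fun p : (List ℕ × ℕ) × Frame => p.2.2.1 := .comp .fst (.comp .snd .snd)
  have n : Primrec fun p : (List ℕ × ℕ) × Frame => p.2.2.2.1 :=
    .comp .fst (.comp .snd (.comp .snd .snd))
  have m : Primrec fun p : (List ℕ × ℕ) × Frame => p.2.2.2.2 :=
    .comp .snd (.comp .snd (.comp .snd .snd))
  have R := primrec_rankC.comp ks
  have ho {x y : (List ℕ × ℕ) × Frame → ℕ} (hx : Primrec x) (hy : Primrec y) :
      Primrec fun p => oNote p.1.1 (rankC p.1.1) (x p) (y p) :=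
    primrec_oNote.comp ((ks.pair R).pair (hx.pair hy))
  have hs {x : (List ℕ × ℕ) × Frame → ℕ} (hx : Primrec x) :
      PrimrecPred fun p => solvedC p.1.1 (x p) = true :=
    Primrec.eq.comp (primrec_solvedC.comp ks hx) (.const true)
  have two {v q i' n' m' : (List ℕ × ℕ) × Frame → ℕ} (hv : Primrec v) (hq : Primrec q)
      (hi : Primrec i') (hn : Primrec n') (hm : Primrec m') :
      Primrec fun p => (v p, ([(0, q p, 0, 0), (i' p, q p, n' p, m' p)] : List Frame)) := by
    have h0 : Primrec fun p => ((0, q p, 0, 0) : Frame) :=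
      (Primrec.const 0).pair (hq.pair (.const (0, 0)))
    have h1 : Primrec fun p => ((i' p, q p, n' p, m' p) : Frame) := hi.pair (hq.pair (hn.pair hm))
    exact hv.pair (Primrec.list_cons.comp h0 (Primrec.list_cons.comp h1 (.const [])))
  have hlt : PrimrecPred fun p : (List ℕ × ℕ) × Frame =>
      oLt (oNote p.1.1 (rankC p.1.1) p.2.2.2.2 p.1.2)
        (oNote p.1.1 (rankC p.1.1) p.2.2.2.1 p.2.2.2.2) = true :=
    Primrec.eq.comp (primrec_oLt.comp (ho m v) (ho n m)) (.const true)
  have hr : PrimrecPred fun p : (List ℕ × ℕ) × Frame => rC p.1.1 p.2.2.2.2 < rC p.1.1 p.2.2.2.1 :=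
    Primrec.nat_lt.comp (primrec_rC.comp ks m) (primrec_rC.comp ks n)
  have h0 : Primrec fun p : (List ℕ × ℕ) × Frame =>
      if p.2.2.1 = 0 then (p.1.2 + 1, ([] : List Frame))
      else if solvedC p.1.1 p.1.2 = true then (p.1.2, [])
      else (p.1.2, [(0, p.2.2.1 - 1, 0, 0), (1, p.2.2.1 - 1, p.1.2, 0)]) :=
    .ite (primrecPred_eq q 0) ((Primrec.succ.comp v).pair (.const [])) <|
      .ite (hs v) (v.pair (.const [])) <| two v (Primrec.pred.comp q) (.const 1) v (.const 0)
  exact .ite (primrecPred_eq i 0) h0 <| .ite (primrecPred_eq i 1) (two v q (.const 2) n v) <|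
    .ite (hlt.and (hr.not.and (hs m).not)) (two v q (.const 2) m v) (m.pair (.const []))

theorem primrec_next : Primrec₂ next := by
  have h : Primrec fun p : (List ℕ × ℕ × List Frame) × Frame => exec p.1.1 p.1.2.1 p.2 :=
    primrec_exec.comp (((Primrec.fst.comp .fst).pair (.comp .fst (.comp .snd .fst))).pair .snd)
  have ht : Primrec fun p : (List ℕ × ℕ × List Frame) × Frame => p.1.2.2.tail :=
    Primrec.list_tail.comp (.comp .snd (.comp .snd .fst))
  have hf := (Primrec.fst.comp h).pair (Primrec.list_append.comp (Primrec.snd.comp h) ht)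
  have hh : Primrec fun p : List ℕ × ℕ × List Frame => p.2.2.head? :=
    Primrec.list_head?.comp (.comp .snd .snd)
  exact Primrec.option_getD.comp (Primrec.option_map hh hf.to₂) .snd

theorem primrec_expo : Primrec₂ expo := by
  have ks : Primrec fun p : List ℕ × Frame => p.1 := .fst
  have i : Primrec fun p : List ℕ × Frame => p.2.1 := .comp .fst .snd
  have q : Primrec fun p : List ℕ × Frame => p.2.2.1 := .comp .fst (.comp .snd .snd)
  have nm : Primrec fun p : List ℕ × Frame => p.2.2.2 := .comp .snd (.comp .snd .snd)
  have R := primrec_rankC.comp ks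
  have ho : Primrec fun p : List ℕ × Frame =>
      ONote.oadd (oNote p.1 (rankC p.1) p.2.2.2.1 p.2.2.2.2) (Nat.succPNat 0) 0 :=
    primrec_oadd.comp ((primrec_oNote.comp ((ks.pair R).pair nm)).pair
      ((Primrec.const 0).pair (.const 0)))
  have hT := primrec_tower.comp (Primrec.succ.comp R)
  exact primrec_oadd.comp (hT.pair (q.pair (.ite (primrecPred_eq i 0) (.const 0)
    (.ite (primrecPred_eq i 1) hT ho))))

theorem primrec_measure : Primrec₂ measure := by
  have hx : Primrec fun p : (List ℕ × List Frame) × ONote × Frame => p.2.1 := .comp .fst .snd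
  have hf : Primrec fun p : (List ℕ × List Frame) × ONote × Frame => expo p.1.1 p.2.2 :=
    primrec_expo.comp (.comp .fst .fst) (.comp .snd .snd)
  have h : Primrec fun p : (List ℕ × List Frame) × ONote × Frame =>
      ONote.oadd (expo p.1.1 p.2.2) (Nat.succPNat 0) p.2.1 :=
    primrec_oadd.comp (hf.pair ((Primrec.const 0).pair hx))
  exact Primrec.list_foldl .snd (.const 0) h.to₂

end Primrec

section Correctness

variable (Cr : CritSeq)

theorem nf_oNote (n m : ℕ) : (oNote (critCodes Cr) (rankC (critCodes Cr)) n m).NF :=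
  (nf_repr_oNote Cr _ n m).1

theorem repr_oNote (n m : ℕ) :
    (oNote (critCodes Cr) (rankC (critCodes Cr)) n m).repr = o Cr n m := by
  rw [(nf_repr_oNote Cr _ n m).2, rankC_code, o]

theorem oNote_lt_iff (n m n' m' : ℕ) :
    oNote (critCodes Cr) (rankC (critCodes Cr)) n m <
      oNote (critCodes Cr) (rankC (critCodes Cr)) n' m' ↔ o Cr n m < o Cr n' m' := by
  rw [ONote.lt_def, repr_oNote, repr_oNote]

theorem oNote_lt_tower (n m : ℕ) : oNote (critCodes Cr) (rankC (critCodes Cr)) n m <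
    tower (rankC (critCodes Cr)) := by
  rw [ONote.lt_def, (nf_repr_oNote Cr _ n m).2]
  exact oAux_lt_tower Cr _ n m

theorem nf_expo (f : Frame) : (expo (critCodes Cr) f).NF := by
  have := nf_oNote Cr f.2.2.1 f.2.2.2
  refine ONote.NF.oadd inferInstance _ ?_
  split_ifs
  · exact .zero
  · refine ONote.NF.below_of_lt' ?_ inferInstance
    rw [← repr_tower_succ]
    exact tower_lt_succ _
  · refine ONote.NF.below_of_lt (LT.lt.trans ?_ (tower_lt_succ _)) (ONote.NF.oadd_zero _ _)
    exact oNote_lt_tower Cr _ _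

theorem expo_lt_of_level_lt {f g : Frame} (h : f.2.1 < g.2.1) :
    expo (critCodes Cr) f < expo (critCodes Cr) g :=
  ONote.oadd_lt_oadd_2 (nf_expo Cr f) (by simpa using h)

theorem expo_eval_lt (q n m n' m' i : ℕ) (hi : i ≠ 0) :
    expo (critCodes Cr) (0, q, n, m) < expo (critCodes Cr) (i, q, n', m') := by
  refine ONote.oadd_lt_oadd_3 ?_
  rw [if_pos rfl, if_neg hi]
  dsimp only
  split_ifs
  · exact ONote.oadd_pos _ _ _
  · exact ONote.oadd_pos _ _ _

theorem expo_loop_lt_start (q n m n' m' : ℕ) :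
    expo (critCodes Cr) (2, q, n, m) < expo (critCodes Cr) (1, q, n', m') :=
  ONote.oadd_lt_oadd_3 (ONote.oadd_lt_oadd_1
    (ONote.NF.oadd_zero _ _ (h := nf_oNote Cr _ _)) (oNote_lt_tower Cr _ _))

theorem expo_loop_lt_loop (q : ℕ) {n m n' m' : ℕ} (h : o Cr n m < o Cr n' m') :
    expo (critCodes Cr) (2, q, n, m) < expo (critCodes Cr) (2, q, n', m') :=
  ONote.oadd_lt_oadd_3 (ONote.oadd_lt_oadd_1
    (ONote.NF.oadd_zero _ _ (h := nf_oNote Cr _ _)) ((oNote_lt_iff Cr _ _ _ _).2 h))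

/-- The exponents of the tasks of a stack decrease towards its top. -/
def Descending (K : List Frame) : Prop :=
  K.Pairwise fun f g => expo (critCodes Cr) f < expo (critCodes Cr) g

variable {Cr}

theorem Descending.replace {f g : Frame} {K : List Frame} (hK : Descending Cr (f :: K))
    (h : expo (critCodes Cr) g < expo (critCodes Cr) f) : Descending Cr (g :: K) := by
  obtain ⟨h1, h2⟩ := List.pairwise_cons.1 hK
  exact List.pairwise_cons.2 ⟨fun x hx => lt_trans h (h1 x hx), h2⟩

theorem Descending.push {f g : Frame} {K : List Frame} (hK : Descending Cr (f :: K))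
    (h : expo (critCodes Cr) g < expo (critCodes Cr) f) : Descending Cr (g :: f :: K) := by
  refine List.pairwise_cons.2 ⟨fun x hx => ?_, hK⟩
  rcases List.mem_cons.1 hx with rfl | hx
  · exact h
  · exact lt_trans h ((List.pairwise_cons.1 hK).1 x hx)

theorem Descending.nf_measure {K : List Frame} (hK : Descending Cr K) :
    (measure (critCodes Cr) K).NF := by
  have key : ∀ (K : List Frame) (x : ONote), Descending Cr K → x.NF →
      (∀ f ∈ K, x.NFBelow (expo (critCodes Cr) f).repr) →
      (K.foldl (fun x f => ONote.oadd (expo (critCodes Cr) f) 1 x) x).NF := by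
    intro K
    induction K with
    | nil => exact fun x _ hx _ => hx
    | cons f K ih =>
      intro x hK hx h
      obtain ⟨h1, h2⟩ := List.pairwise_cons.1 hK
      have hf := h f (by simp)
      exact ih _ h2 (ONote.NF.oadd (nf_expo Cr f) _ hf)
        fun g hg => ONote.NFBelow.oadd (nf_expo Cr f) hf (h1 g hg)
  exact key K 0 hK .zero fun _ _ => .zero

/-- The measure decreases if the task on the top of a stack is replaced by tasks whose terms add up
to less than the term of the replaced task. -/
theorem measure_append_lt {ks : List ℕ} {f : Frame} {K' K : List Frame}
    (h : measure ks K' < ONote.oadd (expo ks f) 1 0) :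
    measure ks (K' ++ K) < measure ks (f :: K) := by
  have key : ∀ (K : List Frame) (x y : ONote), x < y →
      K.foldl (fun x f => ONote.oadd (expo ks f) 1 x) x <
        K.foldl (fun x f => ONote.oadd (expo ks f) 1 x) y := by
    intro K
    induction K with
    | nil => exact fun x y h => h
    | cons f K ih => exact fun x y h => ih _ _ (ONote.oadd_lt_oadd_3 h)
  rw [measure, List.foldl_append]
  exact key K _ _ h

variable {run : ℕ × List Frame → ℕ}

variable (hrun : ∀ s, (measure (critCodes Cr) s.2).NF →
  (measure (critCodes Cr) (next (critCodes Cr) s).2).NF →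
  measure (critCodes Cr) (next (critCodes Cr) s).2 < measure (critCodes Cr) s.2 →
  run s = run (next (critCodes Cr) s))
include hrun

/-- A task which is completed at once. -/
theorem run_pop {f : Frame} {K : List Frame} (hK : Descending Cr (f :: K)) {v v' : ℕ}
    (h : exec (critCodes Cr) v f = (v', [])) : run (v, f :: K) = run (v', K) := by
  have hn : next (critCodes Cr) (v, f :: K) = (v', K) := by simp [next, h]
  have := hrun (v, f :: K) hK.nf_measure
  rw [hn] at this
  exact this (Descending.nf_measure (List.pairwise_cons.1 hK).2)
    (measure_append_lt (K' := []) (ONote.oadd_pos _ _ _))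

/-- A task which is replaced by two tasks of smaller exponents. -/
theorem run_push {f g g' : Frame} {K : List Frame} (hK : Descending Cr (f :: K))
    (hg : expo (critCodes Cr) g < expo (critCodes Cr) g')
    (hg' : expo (critCodes Cr) g' < expo (critCodes Cr) f) {v v' : ℕ}
    (h : exec (critCodes Cr) v f = (v', [g, g'])) :
    run (v, f :: K) = run (v', g :: g' :: K) := by
  have hn : next (critCodes Cr) (v, f :: K) = (v', g :: g' :: K) := by simp [next, h]
  have := hrun (v, f :: K) hK.nf_measure
  rw [hn] at this
  refine this ((hK.replace hg').push hg).nf_measure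
    (measure_append_lt (K' := [g, g']) (ONote.oadd_lt_oadd_1 ?_ hg'))
  exact Descending.nf_measure (K := [g, g']) (by simpa [Descending] using hg)

/-- The machine completes the task of computing `M(p, n)`, and passes the result to the next task on
the stack. -/
theorem run_eval (p n : ℕ) {K : List Frame} (hK : Descending Cr ((0, p, 0, 0) :: K)) :
    run (n, (0, p, 0, 0) :: K) = run (M Cr p n, K) := by
  induction p generalizing n K with
  | zero => exact run_pop hrun hK (by simp [exec, M])
  | succ q ih =>
    -- The loop of level `q`, once `M(q, n)` and `M(q, M(q, n))` are known.
    have loop : ∀ n m, m = M Cr q n → ¬ Solving Cr (proc Cr n) →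
        Descending Cr ((2, q, n, m) :: K) →
        run (M Cr q m, (2, q, n, m) :: K) = run (M Cr (q + 1) n, K) := by
      intro n
      induction h : o Cr n (M Cr q n) using WellFoundedLT.induction generalizing n with
      | _ x ih' =>
        intro m hm hn hK
        subst h hm
        rw [M, MStep, if_neg hn]
        set m := M Cr q n with hm
        have hexec : exec (critCodes Cr) (M Cr q m) (2, q, n, m) =
            if o Cr m (M Cr q m) < o Cr n m ∧ ¬ r Cr m < r Cr n ∧ ¬ Solving Cr (proc Cr m) then
              (M Cr q m, [(0, q, 0, 0), (2, q, m, M Cr q m)]) else (m, []) := by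
          have h1 := oLt_iff (nf_oNote Cr m (M Cr q m)) (nf_oNote Cr n m)
          rw [oNote_lt_iff] at h1
          simp only [exec, h1, rC_code, solvedC_iff]
          rfl
        by_cases h1 : o Cr m (M Cr q m) < o Cr n m
        · by_cases h2 : r Cr m < r Cr n
          · rw [if_neg (by simp [h2])] at hexec
            rw [dif_pos h1, if_pos h2, run_pop hrun hK hexec]
          · by_cases h3 : Solving Cr (proc Cr m)
            · rw [if_neg (by simp [h3])] at hexec
              rw [dif_pos h1, if_neg h2, MStep, if_pos h3, run_pop hrun hK hexec]
            · rw [if_pos ⟨h1, h2, h3⟩] at hexec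
              have hlt := expo_loop_lt_loop Cr q h1
              have hev := expo_eval_lt Cr q 0 0 m (M Cr q m) 2 two_ne_zero
              rw [dif_pos h1, if_neg h2, run_push hrun hK hev hlt hexec,
                ih _ ((hK.replace hlt).push hev)]
              exact ih' _ h1 m rfl _ rfl h3 (hK.replace hlt)
        · rw [if_neg (by simp [h1])] at hexec
          rw [dif_neg h1, run_pop hrun hK hexec]
    by_cases hn : Solving Cr (proc Cr n)
    · rw [M, MStep, if_pos hn]
      exact run_pop hrun hK (by simp [exec, (solvedC_iff Cr n).2 hn])
    · have hn' : ¬ solvedC (critCodes Cr) n = true := fun h => hn ((solvedC_iff Cr n).1 h)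
      have h1 := expo_eval_lt Cr q 0 0 n 0 1 one_ne_zero
      have h2 := expo_lt_of_level_lt Cr (f := (1, q, n, 0)) (g := (0, q + 1, 0, 0)) q.lt_succ_self
      have h3 := expo_eval_lt Cr q 0 0 n (M Cr q n) 2 two_ne_zero
      have h4 := expo_loop_lt_start Cr q n (M Cr q n) n 0
      have hK' := hK.replace h2
      rw [run_push hrun hK h1 h2 (v' := n) (by simp [exec, hn']), ih _ (hK'.push h1),
        run_push hrun hK' h3 h4 (v' := M Cr q n) (by simp [exec]), ih _ ((hK'.replace h4).push h3)]
      exact loop n _ rfl hn (hK'.replace h4)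

end Correctness

end EpsSubst

theorem mainTheorem2 :
    ∃ f : List.Vector ℕ 3 → ℕ, EpsSubst.Eps0Recursive f ∧
      ∀ (p n : ℕ) (Cr : EpsSubst.CritSeq),
        f (p ::ᵥ n ::ᵥ EpsSubst.CritSeq.code Cr ::ᵥ List.Vector.nil) =
          EpsSubst.HProc.M Cr p n := by
  obtain ⟨run, h1, h2, h3⟩ := EpsSubst.exists_run
    (step := fun c s => EpsSubst.next (EpsSubst.seqOf c) s)
    (mu := fun c s => EpsSubst.measure (EpsSubst.seqOf c) s.2) (out := fun _ s => s.1)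
    (EpsSubst.primrec_next.comp (EpsSubst.primrec_seqOf.comp .fst) .snd)
    (EpsSubst.primrec_measure.comp (EpsSubst.primrec_seqOf.comp .fst) (.comp .snd .snd))
    (Primrec.fst.comp .snd)
  have hget (i : Fin 3) : Primrec fun v : List.Vector ℕ 3 => v.get i :=
    Primrec.vector_get.comp .id (.const i)
  have hinit : Primrec fun v : List.Vector ℕ 3 =>
      (v.get 1, ([(0, v.get 0, 0, 0)] : List EpsSubst.Frame)) :=
    (hget 1).pair (Primrec.list_cons.comp
      ((Primrec.const 0).pair ((hget 0).pair (.const (0, 0)))) (.const []))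
  refine ⟨_, h3 (hget 2) hinit, fun p n Cr => ?_⟩
  have hrun := h1 (EpsSubst.CritSeq.code Cr)
  simp only [EpsSubst.seqOf_code] at hrun
  refine (EpsSubst.run_eval hrun p n (List.pairwise_singleton _ _)).trans ?_
  exact h2 _ _ rfl
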